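/- **Setting.** Let $d\ge 1$, $\mathsf X=[0,1)^d$, and let $\lambda_k$ be Lebesgue measure on $[0,1)^k$. For finite measures on $[0,1)^k$ put $\|\mu-\nu\|_E=\sup\{|\mu(B)-\nu(B)| : B=\prod_{i=1}^k[a_i,b_i],\ 0\le a_i<b_i<1\}$, and for a point set $u^{1:N}$ in $[0,1)^k$ put $D(u^{1:N})=\|\frac1N\sum_{n}\delta_{u^n}-\lambda_k\|_E$. *Model.* Let $(x_t)_{t\ge 0}$ be a Markov chain on $\mathsf X$ with initial law $m_0$ and transition kernels $m_t(x_{t-1},dx_t)$, $t\ge1$, and let $G_0:\mathsf X\to[0,\infty)$ and $G_t:\mathsf X\times\mathsf X\to[0,\infty)$, $t\ge 1$. With $Z_t=\mathbb E[G_0(x_0)\prod_{s=1}^tG_s(x_{s-1},x_s)]$, the smoothing distribution $\widetilde{\mathbb Q}_t$ is the law on $\mathsf X^{t+1}$ given by $\widetilde{\mathbb Q}_t(\varphi)=Z_t^{-1}\,\mathbb E[\varphi(x_{0:t})G_0(x_0)\prod_{s=1}^tG_s(x_{s-1},x_s)]$. *Rosenblatt transforms.* For a probability $\pi$ on $\mathsf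 X$ with regular conditional distributions $\pi_i(x_{1:i-1},dx_i)$ of the $i$-th coordinate given the previous ones, $F_\pi(x)$ has $i$-th coordinate $\pi_i(x_{1:i-1},[0,x_i])$, and $F_\pi^{-1}(u)=x$ is defined successively by $x_i=\inf\{s\in[0,1):\pi_i(x_{1:i-1},[0,s])\ge u_i\}$. Write $F_{m_t}(x',\cdot)$ for the transform of $m_t(x',\cdot)$ (for fixed versions $m_{ti}(x',x_{1:i-1},dx_i)$ of its conditional distributions), with $F_{m_0}(x',x)=F_{m_0}(x)$ at $t=0$. *Hilbert curves.* A Hilbert curve in dimension $k\geq 1$ is a continuous map $H:[0,1]\to[0,1]^k$ with $H(0)=0$ which, for every $m\ge0$, maps the $2^{mk}$ consecutive closed intervals of length $2^{-mk}$ bijectively onto the $2^{mk}$ closed dyadic cubes of side $2^{-m}$ (as sets), successive intervals going to distinct cubes that share at least one edge (an end point if $k=1$, in which case $H$ is the identity). For $t\ge 1$ let $H^t$ be a Hilbert curve in dimension $dt$ and $h^t:[0,1]^{dt}\to[0,1]$ a pseudo-inverse: $H^t(h^t(z))=z$ for all $z$. *Algorithm (SQMC forward smoothing).* For each $N$ let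 $\mathbf u_0^{1:N}$ be a point set in $[0,1)^d$ and, for $t\ge1$, let $\mathbf u_t^{1:N}$, $\mathbf u_t^n=(u_t^n,\mathbf v_t^n)$, be a point set in $[0,1)^{1+d}$ labelled so that $u_t^1\le\dots\le u_t^N$. Set $\mathbf z_0^n=x_0^n=F_{m_0}^{-1}(\mathbf u_0^n)$ and $W_0^n=G_0(x_0^n)/\sum_kG_0(x_0^k)$. For $t\ge1$: let $\sigma_{t-1}$ be a permutation with $h^t(\mathbf z_{t-1}^{\sigma_{t-1}(1)})\le\dots\le h^t(\mathbf z_{t-1}^{\sigma_{t-1}(N)})$; let $a_{t-1}^n=\sigma_{t-1}(k)$ with $k$ the smallest index such that $\sum_{i\le k}W_{t-1}^{\sigma_{t-1}(i)}\ge u_t^n$; put $\hat x_{t-1}^n=x_{t-1}^{a_{t-1}^n}$, $x_t^n=F_{m_t}^{-1}(\hat x_{t-1}^n,\mathbf v_t^n)$, $\mathbf z_t^n=(\mathbf z_{t-1}^{a_{t-1}^n},x_t^n)\in\mathsf X^{t+1}$ and $W_t^n=G_t(\hat x_{t-1}^n,x_t^n)/\sum_kG_t(\hat x_{t-1}^k,x_t^k)$.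 **Proposition.** Let $T\ge 0$. Assume $D(\mathbf u_t^{1:N})\to0$ as $N\to\infty$ for every $t\in\{0,\dots,T\}$, and that for every $t\in\{0,\dots,T\}$: 1. for each $N$ the points $x_t^1,\dots,x_t^N$ are pairwise distinct; 2. $G_t$ is continuous and bounded; 3. (a) for $i\in\{1,\dots,d\}$ and fixed $x'$, the $i$-th coordinate of $F_{m_t}(x',x)$ is strictly increasing in $x_i\in[0,1)$; (b) $(x',x)\mapsto F_{m_t}(x',x)$ is Hölder continuous; (c) for $i\in\{1,\dots,d\}$, $m_{ti}(x',x_{1:i-1},dx_i)$ has a density $p_{ti}(x_i|x_{1:i-1},x')$ with respect to Lebesgue measure, bounded uniformly in all its arguments; 4. $\widetilde{\mathbb Q}_t(d\mathbf z_t)=\tilde p_t(\mathbf z_t)\,\lambda_{d(t+1)}(d\mathbf z_t)$ with $\tilde p_t$ a strictly positive bounded density. Then, for every $t\in\{0,\dots,T\}$, $$\Big\|\sum_{n=1}^NW_t^n\,\delta_{\mathbf z_t^n}-\widetilde{\mathbb Q}_t\Big\|_E\longrightarrow0\qquad\text{as }N\to\infty .$$ -/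

import Mathlib

open MeasureTheory ProbabilityTheory Filter Set
open scoped NNReal ENNReal Topology

noncomputable section

namespace SQMC

/-- The half-open unit interval `[0,1)`. -/
abbrev UI : Type := Set.Ico (0 : ℝ) 1

/-- The half-open unit cube `[0,1)^ι`, with its product (sup) metric and product `σ`-algebra. -/
abbrev Cube (ι : Type) : Type := ι → UI

/-- Lebesgue measure on `[0,1)`. -/
def lebUI : Measure UI := (volume : Measure ℝ).comap Subtype.val

/-- Lebesgue measure on `[0,1)^ι`. -/
def lebCube (ι : Type) [Fintype ι] : Measure (Cube ι) := Measure.pi (fun _ => lebUI)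

/-- The state space `[0,1)^d`. -/
abbrev State (d : ℕ) : Type := Cube (Fin d)

/-- The trajectories `z_t = x_{0:t}`, i.e. the points of `[0,1)^{d(t+1)}`; the coordinate `(s, j)`
of `z_t` is the `j`-th coordinate of `x_s`. -/
abbrev Traj (d t : ℕ) : Type := Cube (Fin (t + 1) × Fin d)

/-! ### Extreme norm, empirical measures, discrepancy -/

/-- The extreme norm `‖μ - ν‖_E`: the supremum of `|μ B - ν B|` over the boxes
`B = ∏ [a_i, b_i]`, `0 ≤ a_i < b_i < 1`. -/
def extremeNorm {ι : Type} (μ ν : Measure (Cube ι)) : ℝ≥0∞ :=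
  ⨆ (a : Cube ι) (b : Cube ι) (_ : ∀ i, a i < b i),
    ENNReal.ofReal |μ.real (Set.Icc a b) - ν.real (Set.Icc a b)|

/-- The weighted empirical measure `∑ n, w n • δ_{x n}`. -/
def weightedEmpirical {E : Type} [MeasurableSpace E] {N : ℕ} (w : Fin N → ℝ≥0) (x : Fin N → E) :
    Measure E :=
  ∑ n, (w n : ℝ≥0∞) • Measure.dirac (x n)

/-- The extreme discrepancy `D(u^{1:N})` of a point set in `[0,1)^ι`. -/
def discrepancy {ι : Type} [Fintype ι] {N : ℕ} (u : Fin N → Cube ι) : ℝ≥0∞ :=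
  extremeNorm (weightedEmpirical (fun _ => (N : ℝ≥0)⁻¹) u) (lebCube ι)

/-! ### Hilbert curves -/

/-- `H : [0,1] → [0,1]^n` (`n = card ι`) is a Hilbert curve starting at the origin: `H` is
continuous, `H 0 = 0`, and for every level `m` it maps the `2^{mn}` consecutive closed intervals of
length `2^{-mn}` onto the `2^{mn}` closed dyadic cubes of side `2^{-m}`, each cube being visited
once, and two successive cubes being adjacent (with an edge in common when `n ≥ 2`, an end point
when `n = 1`). Here `c m k` is the integer position of the `k`-th cube of level `m`. The cubes of
level `m + 1` visited inside an interval of level `m` split the cube of that interval, since the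
sub-intervals have their images inside it. For `n = 1` the identity is the only such curve. -/
structure IsHilbertCurve {ι : Type} [Fintype ι] (H : unitInterval → ι → unitInterval) : Prop where
  continuous : Continuous H
  map_zero : H 0 = 0
  cells : ∃ c : ℕ → ℕ → ι → ℕ, ∀ m : ℕ,
    Set.BijOn (c m) (Set.Iio (2 ^ (m * Fintype.card ι))) {q | ∀ j, q j < 2 ^ m} ∧
    (∀ k : ℕ, k < 2 ^ (m * Fintype.card ι) →
      H '' {s | (k : ℝ) / 2 ^ (m * Fintype.card ι) ≤ s ∧
                (s : ℝ) ≤ (k + 1) / 2 ^ (m * Fintype.card ι)} =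
        {x | ∀ j, (c m k j : ℝ) / 2 ^ m ≤ x j ∧ (x j : ℝ) ≤ (c m k j + 1) / 2 ^ m}) ∧
    (∀ k : ℕ, k + 1 < 2 ^ (m * Fintype.card ι) →
      (∀ j, c m k j ≤ c m (k + 1) j + 1 ∧ c m (k + 1) j ≤ c m k j + 1) ∧
      (Fintype.card ι = 1 ∨ ∃ j, c m k j = c m (k + 1) j))

/-- The inclusion of `[0,1)^ι` in `[0,1]^ι`. -/
def toClosed {ι : Type} (x : Cube ι) : ι → unitInterval :=
  fun i => ⟨x i, (x i).2.1, (x i).2.2.le⟩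

/-! ### Rosenblatt transform -/

/-- A family of candidates for the laws of `x_i` given `(x_1, …, x_{i-1})`, `i = 1, …, d`. -/
abbrev CondLaws (d : ℕ) : Type := (i : Fin d) → Kernel (Fin (i : ℕ) → UI) UI

/-- The coordinates of `x` before the `i`-th one. -/
def before {d : ℕ} (i : Fin d) (x : State d) : Fin (i : ℕ) → UI :=
  fun j => x (Fin.castLE i.2.le j)

/-- `κ i` is, for every `i`, a (regular) conditional distribution, relative to `π`, of the `i`-th
coordinate given the previous ones. -/
def IsCondLaws {d : ℕ} (π : Measure (State d)) (κ : CondLaws d) : Prop :=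
  ∀ i, IsMarkovKernel (κ i) ∧ (π.map (fun x => (before i x, x i))).IsCondKernel (κ i)

/-- The Rosenblatt transform: its `i`-th coordinate is the conditional distribution function of
the `i`-th coordinate given the previous ones, at the point `x`. -/
def rosenblatt {d : ℕ} (κ : CondLaws d) (x : State d) : Fin d → ℝ :=
  fun i => (κ i (before i x)).real (Set.Iic (x i))

lemma sInf_image_mem (S : Set UI) : sInf ((fun s : UI => (s : ℝ)) '' S) ∈ Set.Ico (0 : ℝ) 1 := by
  rcases S.eq_empty_or_nonempty with rfl | ⟨s, hs⟩
  · simp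
  · refine ⟨Real.sInf_nonneg ?_, ?_⟩
    · rintro _ ⟨y, _, rfl⟩
      exact y.2.1
    · refine lt_of_le_of_lt (csInf_le ⟨0, ?_⟩ ⟨s, hs, rfl⟩) s.2.2
      rintro _ ⟨y, _, rfl⟩
      exact y.2.1

/-- The inverse distribution function `inf {s ∈ [0,1) : π [0,s] ≥ u}`. -/
def quantile (π : Measure UI) (u : UI) : UI :=
  ⟨sInf ((fun s : UI => (s : ℝ)) '' {s : UI | (u : ℝ) ≤ π.real (Set.Iic s)}), sInf_image_mem _⟩

/-- The inverse Rosenblatt transform: successively for `i = 1, …, d`, the `i`-th coordinate is the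
inverse conditional distribution function, given the coordinates already obtained, at `u i`. -/
def invRosenblatt {d : ℕ} (κ : CondLaws d) (u : State d) (i : Fin d) : UI :=
  quantile (κ i (fun j : Fin (i : ℕ) => invRosenblatt κ u (Fin.castLE i.2.le j))) (u i)
termination_by (i : ℕ)
decreasing_by exact j.2

/-- The regularity conditions on the Rosenblatt transform `F(x', x)` of a family, indexed by `x'`,
of distributions on `[0,1)^d` with conditional distributions `κ x' i`. -/
structure RegularRosenblatt {α : Type} [PseudoEMetricSpace α] {d : ℕ} (κ : α → CondLaws d) :
    Prop where
  /-- For fixed `x'`, the `i`-th coordinate of `F(x', x)` is strictly increasing in `x_i`. -/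
  strictMono : ∀ x' i y, StrictMono (fun s : UI => (κ x' i y).real (Set.Iic s))
  /-- `(x', x) ↦ F(x', x)` is Hölder continuous. -/
  holder : ∃ C r : ℝ≥0, 0 < r ∧ r ≤ 1 ∧
    HolderWith C r (fun p : α × State d => rosenblatt (κ p.1) p.2)
  /-- The conditional distributions have uniformly bounded densities. -/
  density : ∃ C : ℝ≥0, ∀ x' i y, ∃ p : UI → ℝ≥0, Measurable p ∧ (∀ s, p s ≤ C) ∧
    κ x' i y = lebUI.withDensity (fun s => (p s : ℝ≥0∞))

/-! ### Feynman-Kac models -/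

/-- A Feynman-Kac model on `[0,1)^d`: initial distribution `m0`, transition kernels `m t` (from
time `t - 1` to time `t`, for `t ≥ 1`) and non-negative potentials `G0` and `G t` (`t ≥ 1`).
The values `m 0` and `G 0` play no role. -/
structure FeynmanKac (d : ℕ) where
  m0 : Measure (State d)
  m : ℕ → Kernel (State d) (State d)
  G0 : State d → ℝ≥0
  G : ℕ → State d → State d → ℝ≥0
  prob_m0 : IsProbabilityMeasure m0
  markov_m : ∀ t, IsMarkovKernel (m t)

/-- The state `x_s` of a trajectory `x_{0:t}`. -/
def state {d t : ℕ} (z : Traj d t) (s : Fin (t + 1)) : State d := fun j => z (s, j)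

/-- The trajectory of length one `x_{0:0} = x_0`. -/
def single {d : ℕ} (x : State d) : Traj d 0 := fun p => x p.2

/-- The trajectory `x_{0:t+1} = (x_{0:t}, x_{t+1})`. -/
def snocState {d t : ℕ} (z : Traj d t) (x : State d) : Traj d (t + 1) :=
  fun p => Fin.snoc (α := fun _ => State d) (state z) x p.1 p.2

/-- The final state `x_t` of `x_{0:t}`. -/
def lastState {d t : ℕ} (z : Traj d t) : State d := state z (Fin.last t)

lemma measurable_lastState {d t : ℕ} : Measurable (lastState : Traj d t → State d) :=
  measurable_pi_lambda _ fun j => measurable_pi_apply (Fin.last t, j)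

lemma measurable_single {d : ℕ} : Measurable (single : State d → Traj d 0) :=
  measurable_pi_lambda _ fun p => measurable_pi_apply p.2

lemma measurable_snocState {d t : ℕ} :
    Measurable (fun p : Traj d t × State d => snocState p.1 p.2) := by
  refine measurable_pi_lambda _ fun q => ?_
  obtain ⟨s, j⟩ := q
  induction s using Fin.lastCases with
  | last =>
    have : Measurable (fun p : Traj d t × State d => p.2 j) := by fun_prop
    simpa [snocState] using this
  | cast s =>
    have : Measurable (fun p : Traj d t × State d => p.1 (s, j)) := by fun_prop
    simpa [snocState, state] using this

namespace FeynmanKac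

variable {d : ℕ} (M : FeynmanKac d)

/-- The law of `x_{0:t}` for the Markov chain with initial law `m0` and transitions `m t`. -/
def pathLaw : (t : ℕ) → Measure (Traj d t)
  | 0 => M.m0.map single
  | t + 1 => ((pathLaw t) ⊗ₘ ((M.m (t + 1)).comap lastState measurable_lastState)).map
      (fun p => snocState p.1 p.2)

/-- `G_0(x_0) ∏_{s=1}^t G_s(x_{s-1}, x_s)`. -/
def pathPotential (t : ℕ) (z : Traj d t) : ℝ≥0 :=
  M.G0 (state z 0) * ∏ s : Fin t, M.G (s + 1) (state z s.castSucc) (state z s.succ)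

/-- The normalising constant `Z_t`. -/
def Z (t : ℕ) : ℝ≥0∞ := ∫⁻ z, (M.pathPotential t z : ℝ≥0∞) ∂(M.pathLaw t)

/-- The smoothing distribution at time `t`, a measure on the trajectories `x_{0:t}`. -/
def smoothing (t : ℕ) : Measure (Traj d t) :=
  (M.Z t)⁻¹ • (M.pathLaw t).withDensity (fun z => (M.pathPotential t z : ℝ≥0∞))

/-! ### SQMC forward smoothing -/

/-- The potential at time `t` of a trajectory: `G_0(x_0)` if `t = 0`, else `G_t(x_{t-1}, x_t)`. -/
def potential : (t : ℕ) → Traj d t → ℝ≥0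
  | 0, z => M.G0 (state z 0)
  | t + 1, z => M.G (t + 1) (state z (Fin.last t).castSucc) (state z (Fin.last (t + 1)))

/-- The normalised weights `W_t^n` of the trajectories `z^{1:N}`. -/
def weights {N : ℕ} (t : ℕ) (z : Fin N → Traj d t) (n : Fin N) : ℝ≥0 :=
  M.potential t (z n) / ∑ k, M.potential t (z k)

end FeynmanKac

open Classical in
/-- The inverse at `u` of the distribution function `k ↦ ∑_{i ≤ k} w i` on the indices: the
smallest `k` with `∑_{i ≤ k} w i ≥ u` (it exists when the weights add up to one; the value
`default` is used otherwise). -/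
def invIndex {N : ℕ} (w : Fin N → ℝ≥0) (u : UI) (default : Fin N) : Fin N :=
  if hk : (Finset.univ.filter
      (fun k : Fin N => (u : ℝ) ≤ ((∑ i ∈ Finset.Iic k, w i : ℝ≥0) : ℝ))).Nonempty
  then Finset.min' _ hk else default

/-- The trajectories `z_t^{1:N}` of SQMC forward smoothing. The map `h t` (pseudo-inverse of a
Hilbert curve in dimension `d (t + 1)`) is used to sort `z_t^{1:N}`; `κ0` and `κ t x'` are the
conditional distributions which define the Rosenblatt transforms of `m_0` and `m_t(x', ·)`;
`u0 n ∈ [0,1)^d` and `u t n = (u_t^n, v_t^n) ∈ [0,1)^{1+d}` are the input points. -/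
def trajectories {d : ℕ} (M : FeynmanKac d) (κ0 : CondLaws d) (κ : ℕ → State d → CondLaws d)
    (h : (t : ℕ) → (Fin (t + 1) × Fin d → unitInterval) → unitInterval) {N : ℕ}
    (u0 : Fin N → State d) (u : ℕ → Fin N → Cube (Fin (d + 1))) :
    (t : ℕ) → Fin N → Traj d t
  | 0, n => single (invRosenblatt κ0 (u0 n))
  | t + 1, n =>
    let z : Fin N → Traj d t := trajectories M κ0 κ h u0 u t
    let σ : Equiv.Perm (Fin N) := Tuple.sort (fun k => h t (toClosed (z k)))
    let a : Fin N := σ (invIndex (fun i => M.weights t z (σ i)) (u (t + 1) n 0) n)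
    snocState (z a) (invRosenblatt (κ (t + 1) (lastState (z a))) (Fin.tail (u (t + 1) n)))

end SQMC

end

open SQMC

namespace SQMC

/-! ### Lebesgue measure on the half-open cube -/

/-! The extreme norm is awkward to propagate through one step of the algorithm, but weak convergence
is easy to propagate, and the two agree at the end. If the limit has a bounded density, a box can be
sandwiched between unions of grid cells whose difference has small mass uniformly in the box, so
weak convergence gives `WeakConv.tendsto_extremeNorm`. It remains to prove weak convergence of the
weighted trajectories by induction on time. One step has three stages.

Resampling (`WeakConv.resample`). After sorting by the Hilbert key, the indices whose key lies in a
lower set form an initial segment, so inverting the weight distribution function at `u` selects one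
of them exactly when `u` is at most their total weight (`ancestor_mem_iff`). Counting the resampled
points with key in that set and remaining input `v` in a box thus amounts to counting input points
in a slice `[0, p] × box`, which the discrepancy controls. Taking differences gives the same for
intervals of keys. The curve is uniformly continuous, so points with close keys are close, and a
test function may be frozen on each of finitely many key intervals. Hence the pairs (resampled
trajectory, `v`) converge to `Q_t ⊗ λ`.

Mutation. The inverse Rosenblatt transform is jointly continuous, because the conditional
distribution functions are continuous in their parameters and strictly increasing
(`RegularRosenblatt.continuous_invRosenblatt`), and it sends `λ` to the kernel
(`RegularRosenblatt.lebCube_map`). Weak convergence passes through this continuous map.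

Reweighting (`WeakConv.reweight`). A continuous bounded potential allows passage to the limit in
numerator and denominator of the weights, and `FeynmanKac.smoothing_succ` identifies the limit as
the next smoothing distribution. -/

lemma lebUI_apply (s : Set UI) : lebUI s = volume ((Subtype.val : UI → ℝ) '' s) :=
  (MeasurableEmbedding.subtype_coe measurableSet_Ico).comap_apply _ _

instance isProbabilityMeasure_lebUI : IsProbabilityMeasure lebUI :=
  ⟨by rw [lebUI_apply, image_univ, Subtype.range_coe]; simp⟩

instance isProbabilityMeasure_lebCube (ι : Type) [Fintype ι] :
    IsProbabilityMeasure (lebCube ι) := by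
  unfold lebCube; infer_instance

lemma lebUI_Icc (a b : UI) : lebUI (Icc a b) = ENNReal.ofReal (b - a) := by
  rw [lebUI_apply, ← Real.volume_Icc]
  congr 1
  ext x
  constructor
  · rintro ⟨y, hy, rfl⟩
    exact hy
  · intro hx
    exact ⟨⟨x, a.2.1.trans hx.1, hx.2.trans_lt b.2.2⟩, hx, rfl⟩

lemma lebUI_abs_sub_le (a : ℝ) {ε : ℝ} :
    lebUI {x : UI | |(x : ℝ) - a| ≤ ε} ≤ ENNReal.ofReal (2 * ε) := by
  have : ENNReal.ofReal (2 * ε) = volume (Icc (a - ε) (a + ε)) := by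
    rw [Real.volume_Icc]; congr 1; ring
  rw [lebUI_apply, this]
  refine measure_mono ?_
  rintro _ ⟨y, hy, rfl⟩
  rw [mem_ofPred_eq, abs_le] at hy
  constructor <;> linarith [hy.1, hy.2]

/-! ### Quantiles -/

lemma tendsto_measure_Iic_nhdsGT (π : Measure UI) [IsProbabilityMeasure π] (s : UI) :
    Tendsto (fun t => π.real (Iic t)) (𝓝[>] s) (𝓝 (π.real (Iic s))) := by
  have h := tendsto_measure_biInter_gt (μ := π) (s := fun t : UI => Iic t) (a := s)
    (fun r _ => measurableSet_Iic.nullMeasurableSet)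
    (fun i j _ hij => Iic_subset_Iic.2 hij)
    ⟨_, (exists_gt s).choose_spec, measure_ne_top _ _⟩
  have h2 : (⋂ r > s, Iic r) = Iic s := by
    ext x
    simp only [mem_iInter, mem_Iic]
    exact ⟨fun hx => le_of_forall_gt_imp_ge_of_dense hx, fun hx r hr => hx.trans hr.le⟩
  rw [h2] at h
  exact (ENNReal.tendsto_toReal (measure_ne_top _ _)).comp h

lemma tendsto_measure_Iic_atTop_one (π : Measure UI) [IsProbabilityMeasure π] :
    Tendsto (fun t => π.real (Iic t)) atTop (𝓝 1) := by
  have h := (ENNReal.tendsto_toReal (measure_ne_top π univ)).comp (tendsto_measure_Iic_atTop π)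
  rw [measure_univ, ENNReal.toReal_one] at h
  exact h

/-- Right continuity of the distribution function makes the infimum attained. This Galois connection
is the only property of quantiles used afterwards. -/
lemma quantile_le_iff (π : Measure UI) [IsProbabilityMeasure π] (u s : UI) :
    quantile π u ≤ s ↔ (u : ℝ) ≤ π.real (Iic s) := by
  constructor
  · intro h
    by_contra! hlt
    obtain ⟨s', hs', hss'⟩ := (((tendsto_measure_Iic_nhdsGT π s).eventually_lt_const hlt).and
      self_mem_nhdsWithin).exists
    obtain ⟨r, hr⟩ := ((tendsto_measure_Iic_atTop_one π).eventually_const_lt u.2.2).exists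
    have : (s' : ℝ) ≤ (quantile π u : ℝ) := by
      refine le_csInf ⟨_, r, hr.le, rfl⟩ ?_
      rintro _ ⟨y, hy, rfl⟩
      by_contra! hys
      have hys' : y ≤ s' := le_of_lt hys
      exact absurd (hy.trans (measureReal_mono (Iic_subset_Iic.2 hys'))) (not_le.2 hs')
    exact absurd (this.trans h) (not_le.2 hss')
  · intro h
    have hb : BddBelow ((fun s : UI => (s : ℝ)) '' {s : UI | (u : ℝ) ≤ π.real (Iic s)}) := by
      refine ⟨0, ?_⟩
      rintro _ ⟨y, _, rfl⟩
      exact y.2.1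
    exact csInf_le hb ⟨s, h, rfl⟩

lemma measurable_quantile (π : Measure UI) [IsProbabilityMeasure π] : Measurable (quantile π) := by
  refine measurable_of_Iic fun s => ?_
  have : quantile π ⁻¹' Iic s = {u : UI | (u : ℝ) ≤ π.real (Iic s)} := by
    ext u; exact quantile_le_iff π u s
  rw [this]
  exact measurableSet_le measurable_subtype_coe measurable_const

lemma lebUI_map_quantile (π : Measure UI) [IsProbabilityMeasure π] :
    lebUI.map (quantile π) = π := by
  have := Measure.isProbabilityMeasure_map (μ := lebUI) (measurable_quantile π).aemeasurable
  refine Measure.ext_of_Iic _ _ fun s => ?_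
  rw [Measure.map_apply (measurable_quantile π) measurableSet_Iic]
  have : quantile π ⁻¹' Iic s = {u : UI | (u : ℝ) ≤ π.real (Iic s)} := by
    ext u; exact quantile_le_iff π u s
  rw [this, lebUI_apply]
  have h1 : π.real (Iic s) ≤ 1 := measureReal_le_one
  have h0 : 0 ≤ π.real (Iic s) := measureReal_nonneg
  have h2 : (Subtype.val : UI → ℝ) '' {u : UI | (u : ℝ) ≤ π.real (Iic s)}
      = Ico 0 1 ∩ Iic (π.real (Iic s)) := by
    ext x; constructor
    · rintro ⟨y, hy, rfl⟩; exact ⟨y.2, hy⟩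
    · rintro ⟨hx, hx'⟩; exact ⟨⟨x, hx⟩, hx', rfl⟩
  have h3 : volume (Ico 0 1 ∩ Iic (π.real (Iic s))) = volume (Icc 0 (π.real (Iic s))) := by
    refine le_antisymm (measure_mono fun x hx => ⟨hx.1.1, hx.2⟩) ?_
    rw [← Ico_ae_eq_Icc.measure_eq]
    exact measure_mono fun x hx => ⟨⟨hx.1, hx.2.trans_le h1⟩, hx.2.le⟩
  rw [h2, h3, Real.volume_Icc, sub_zero, ofReal_measureReal]

/-- Joint continuity of the quantile function in the measure and the level. -/
lemma continuousAt_quantile {β : Type*} [TopologicalSpace β] {ρ : β → Measure UI} {v : β → UI}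
    [∀ b, IsProbabilityMeasure (ρ b)] {b₀ : β} (hv : ContinuousAt v b₀)
    (hρ : ∀ s, ContinuousAt (fun b => (ρ b).real (Iic s)) b₀)
    (hmono : StrictMono (fun s : UI => (ρ b₀).real (Iic s))) :
    ContinuousAt (fun b => quantile (ρ b) (v b)) b₀ := by
  have hv' : ContinuousAt (fun b => (v b : ℝ)) b₀ := continuous_subtype_val.continuousAt.comp hv
  refine tendsto_order.2 ⟨fun s hs => ?_, fun s hs => ?_⟩
  · have h : (ρ b₀).real (Iic s) < v b₀ := by
      rw [← not_le, ← quantile_le_iff]; exact not_le.2 hs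
    filter_upwards [(hρ s).eventually_lt hv' h] with b hb
    rw [← not_le, quantile_le_iff]; exact not_le.2 hb
  -- At the quantile itself only `v ≤ F` is known; strict monotonicity makes it strict at a larger
  -- `r`, and a strict inequality persists near `b₀`.
  · obtain ⟨r, hr1, hr2⟩ := exists_between hs
    have h : (v b₀ : ℝ) < (ρ b₀).real (Iic r) :=
      ((quantile_le_iff _ _ _).1 le_rfl).trans_lt (hmono hr1)
    filter_upwards [hv'.eventually_lt (hρ r) h] with b hb
    exact ((quantile_le_iff _ _ _).2 hb.le).trans_lt hr2

/-! ### The inverse Rosenblatt transform -/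

/-- The first `k` coordinates of a state. -/
def firstCoords {d k : ℕ} (hk : k ≤ d) (x : State d) : Fin k → UI := fun j => x (Fin.castLE hk j)

lemma measurable_firstCoords {d k : ℕ} (hk : k ≤ d) : Measurable (firstCoords hk) :=
  measurable_pi_lambda _ fun _ => measurable_pi_apply _

lemma invRosenblatt_eq {d : ℕ} (κ : CondLaws d) (u : State d) (i : Fin d) :
    invRosenblatt κ u i = quantile (κ i (before i (invRosenblatt κ u))) (u i) := by
  rw [invRosenblatt]; rfl

lemma invRosenblatt_congr {d : ℕ} (κ : CondLaws d) {u v : State d} (i : Fin d)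
    (h : ∀ j ≤ i, u j = v j) : invRosenblatt κ u i = invRosenblatt κ v i := by
  induction i using WellFoundedLT.induction with
  | ind i ih =>
    rw [invRosenblatt_eq, invRosenblatt_eq, h i le_rfl]
    congr 2
    funext j
    have hj : Fin.castLE i.2.le j < i := j.2
    exact ih _ hj fun k hk => h k (hk.trans hj.le)

/-- The state with first coordinates `y`, next coordinate `s`, and `0` afterwards. -/
def extendCoords {d : ℕ} (i : Fin d) (y : Fin (i : ℕ) → UI) (s : UI) : State d :=
  fun j => if h : (j : ℕ) < i then y ⟨j, h⟩ else if j = i then s else 0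

lemma before_extendCoords {d : ℕ} (i : Fin d) (y : Fin (i : ℕ) → UI) (s : UI) :
    before i (extendCoords i y s) = y := by
  funext j
  simp [before, extendCoords]

lemma extendCoords_self {d : ℕ} (i : Fin d) (y : Fin (i : ℕ) → UI) (s : UI) :
    extendCoords i y s i = s := by
  simp [extendCoords]

lemma continuous_extendCoords {d : ℕ} (i : Fin d) (s : UI) :
    Continuous (fun y => extendCoords i y s) := by
  refine continuous_pi fun j => ?_
  unfold extendCoords
  split_ifs
  · exact continuous_apply _
  · exact continuous_const
  · exact continuous_const

/-- This function is a coordinate of the Rosenblatt transform evaluated at a state padded with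
zeros, so Hölder continuity of the transform applies. -/
lemma RegularRosenblatt.continuous_cdf {α : Type} [PseudoEMetricSpace α] {d : ℕ}
    {κ : α → CondLaws d} (h : RegularRosenblatt κ) (i : Fin d) (s : UI) :
    Continuous (fun p : α × (Fin (i : ℕ) → UI) => (κ p.1 i p.2).real (Iic s)) := by
  obtain ⟨C, r, hr, -, hh⟩ := h.holder
  have h1 : Continuous (fun p : α × State d => rosenblatt (κ p.1) p.2 i) :=
    (continuous_apply i).comp (hh.continuous hr)
  have h2 := h1.comp (continuous_fst.prodMk ((continuous_extendCoords i s).comp continuous_snd) :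
    Continuous (fun p : α × (Fin (i : ℕ) → UI) => (p.1, extendCoords i p.2 s)))
  refine h2.congr fun p => ?_
  simp [rosenblatt, before_extendCoords, extendCoords_self]

/-- By strong induction on the coordinate, each coordinate is the quantile of a law varying
continuously with `x'` and the coordinates already built. -/
lemma RegularRosenblatt.continuous_invRosenblatt {α : Type} [PseudoEMetricSpace α] {d : ℕ}
    {κ : α → CondLaws d} (h : RegularRosenblatt κ) (hκ : ∀ a i, IsMarkovKernel (κ a i)) :
    Continuous (fun p : α × State d => invRosenblatt (κ p.1) p.2) := by
  refine continuous_pi fun i => ?_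
  induction i using WellFoundedLT.induction with
  | ind i ih =>
    simp_rw [invRosenblatt_eq]
    have hb : Continuous (fun p : α × State d => before i (invRosenblatt (κ p.1) p.2)) :=
      continuous_pi fun j => ih _ (show Fin.castLE i.2.le j < i from j.2)
    refine continuous_iff_continuousAt.2 fun p => ?_
    refine continuousAt_quantile (ρ := fun p : α × State d =>
      κ p.1 i (before i (invRosenblatt (κ p.1) p.2))) ?_ (fun s => ?_) (h.strictMono _ _ _)
    · exact ((continuous_apply i).comp continuous_snd).continuousAt
    · exact ((h.continuous_cdf i s).comp (continuous_fst.prodMk hb)).continuousAt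

/-- The transform is triangular: its coordinates before `i` are functions of the inputs `u j`, `j <
i`, which are independent of `u i`. The map `φ` pads those inputs with zeros. -/
lemma indepFun_firstCoords_apply {d : ℕ} (κ : CondLaws d)
    (hm : Measurable (invRosenblatt κ)) (i : Fin d) :
    IndepFun (fun u => before i (invRosenblatt κ u)) (fun u => u i) (lebCube (Fin d)) := by
  have h0 : iIndepFun (fun (j : Fin d) (u : State d) => u j) (lebCube (Fin d)) :=
    iIndepFun_pi (μ := fun _ : Fin d => lebUI) (X := fun _ => id) fun _ => aemeasurable_id
  have h1 := h0.indepFun_finset (Finset.Iio i) {i} (by simp) (fun j => measurable_pi_apply j)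
  let φ : (Finset.Iio i → UI) → State d := fun w j =>
    if hj : j ∈ Finset.Iio i then w ⟨j, hj⟩ else 0
  have hφ : Measurable φ := by
    refine measurable_pi_lambda _ fun j => ?_
    simp only [φ]
    split_ifs
    · exact measurable_pi_apply _
    · exact measurable_const
  have hψ : Measurable (fun w : ({i} : Finset (Fin d)) → UI => w ⟨i, Finset.mem_singleton_self i⟩) :=
    measurable_pi_apply _
  have h2 := h1.comp (φ := fun w => before i (invRosenblatt κ (φ w)))
    (((measurable_firstCoords i.2.le).comp hm).comp hφ) hψ
  refine h2.congr (ae_of_all _ fun u => ?_) (ae_of_all _ fun u => rfl)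
  funext j
  refine invRosenblatt_congr κ _ fun k hk => ?_
  have hki : k ∈ Finset.Iio i := Finset.mem_Iio.2 (hk.trans_lt j.2)
  simp [φ, Finset.mem_Iio.1 hki]

lemma map_snoc_firstCoords {d k : ℕ} (hk : k + 1 ≤ d) (x : State d) :
    Fin.snoc (α := fun _ => UI) (firstCoords (Nat.le_of_succ_le hk) x) (x ⟨k, hk⟩) =
      firstCoords hk x := by
  funext j
  induction j using Fin.lastCases with
  | last => simp [firstCoords]; rfl
  | cast j => simp [firstCoords]

/-- Induction on the number `k` of leading coordinates: by independence and `lebUI_map_quantile`,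
the next coordinate has, given the first `k`, the conditional law that disintegrates `π`. -/
lemma lebCube_map_invRosenblatt {d : ℕ} {π : Measure (State d)} [IsProbabilityMeasure π]
    {κ : CondLaws d} (hκ : IsCondLaws π κ) (hm : Measurable (invRosenblatt κ))
    (hq : ∀ i : Fin d, Measurable fun p : (Fin (i : ℕ) → UI) × UI => quantile (κ i p.1) p.2) :
    (lebCube (Fin d)).map (invRosenblatt κ) = π := by
  have key : ∀ k (hk : k ≤ d), (lebCube (Fin d)).map (fun u => firstCoords hk (invRosenblatt κ u))
      = π.map (firstCoords hk) := by
    intro k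
    induction k with
    | zero =>
      intro hk
      have e1 : (fun u => firstCoords hk (invRosenblatt κ u)) = fun _ => Fin.elim0 := by
        funext u j; exact j.elim0
      have e2 : firstCoords hk = fun _ => Fin.elim0 := by
        funext u j; exact j.elim0
      rw [e1, e2]
      simp [Measure.map_const]
    | succ k ih =>
      intro hk
      have hk' : k ≤ d := Nat.le_of_succ_le hk
      let i : Fin d := ⟨k, hk⟩
      obtain ⟨hM, hC⟩ := hκ i
      have hb : Measurable (before i) := measurable_firstCoords i.2.le
      have hpair : Measurable (fun x : State d => (before i x, x i)) :=
        hb.prodMk (measurable_pi_apply i)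
      have hsnoc : Measurable (fun p : (Fin k → UI) × UI =>
          (Fin.snoc (α := fun _ => UI) p.1 p.2 : Fin (k + 1) → UI)) := by
        refine measurable_pi_lambda _ fun j => ?_
        induction j using Fin.lastCases with
        | last => simpa using measurable_snd
        | cast j => simpa [Function.comp_def] using (measurable_pi_apply j).comp (measurable_fst (β := UI))
      have hpair_eq : (lebCube (Fin d)).map
          (fun u => (before i (invRosenblatt κ u), invRosenblatt κ u i)) =
          π.map (fun x => (before i x, x i)) := by
        have hind := (indepFun_iff_map_prod_eq_prod_map_map (hb.comp hm).aemeasurable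
          (measurable_pi_apply i).aemeasurable).1 (indepFun_firstCoords_apply κ hm i)
        have hi : (lebCube (Fin d)).map (fun u => u i) = lebUI :=
          (measurePreserving_eval (fun _ : Fin d => lebUI) i).map_eq
        rw [hi] at hind
        have e : (lebCube (Fin d)).map (fun u => before i (invRosenblatt κ u)) =
          π.map (before i) := ih hk'
        simp only [Function.comp_def] at hind
        rw [e] at hind
        have hg : Measurable (fun p : (Fin (i : ℕ) → UI) × UI => (p.1, quantile (κ i p.1) p.2)) :=
          measurable_fst.prodMk (hq i)
        have e2 : (fun u => (before i (invRosenblatt κ u), invRosenblatt κ u i)) =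
            (fun p : (Fin (i : ℕ) → UI) × UI => (p.1, quantile (κ i p.1) p.2)) ∘
            (fun u => (before i (invRosenblatt κ u), u i)) := by
          funext u; simp only [Function.comp]; rw [invRosenblatt_eq]
        have hbm : Measurable (fun u => (before i (invRosenblatt κ u), u i)) :=
          (hb.comp hm).prodMk (measurable_pi_apply i)
        rw [e2, ← Measure.map_map hg hbm, hind]
        have hdis := hC.disintegrate
        rw [Measure.fst_map_prodMk (measurable_pi_apply i)] at hdis
        rw [← hdis]
        have := Measure.isProbabilityMeasure_map (μ := π) hb.aemeasurable
        ext s hs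
        rw [Measure.map_apply hg hs, Measure.prod_apply (hg hs), Measure.compProd_apply hs]
        refine lintegral_congr fun y => ?_
        have := (hM.isProbabilityMeasure y)
        conv_rhs => rw [← lebUI_map_quantile (κ i y)]
        rw [Measure.map_apply (measurable_quantile _) (measurable_prodMk_left hs)]
        rfl
      have e3 : (fun u => firstCoords hk (invRosenblatt κ u)) =
          (fun p : (Fin k → UI) × UI =>
            (Fin.snoc (α := fun _ => UI) p.1 p.2 : Fin (k + 1) → UI)) ∘
          (fun u => (before i (invRosenblatt κ u), invRosenblatt κ u i)) := by
        funext u; exact (map_snoc_firstCoords hk _).symm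
      have e4 : firstCoords hk =
          (fun p : (Fin k → UI) × UI =>
            (Fin.snoc (α := fun _ => UI) p.1 p.2 : Fin (k + 1) → UI)) ∘
          (fun x => (before i x, x i)) := by
        funext u; exact (map_snoc_firstCoords hk _).symm
      have hbm : Measurable (fun u => (before i (invRosenblatt κ u), invRosenblatt κ u i)) :=
        (hb.comp hm).prodMk ((measurable_pi_apply i).comp hm)
      rw [e3, e4, ← Measure.map_map hsnoc hpair, ← hpair_eq, Measure.map_map hsnoc hbm]
  have := key d le_rfl
  have hid : (firstCoords le_rfl : State d → State d) = id := by
    funext x j; rfl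
  rw [hid, Measure.map_id] at this
  exact this

lemma RegularRosenblatt.lebCube_map {α : Type} [PseudoEMetricSpace α] {d : ℕ}
    {κ : α → CondLaws d} (h : RegularRosenblatt κ) {a : α} {π : Measure (State d)}
    [IsProbabilityMeasure π] (hκ : ∀ a i, IsMarkovKernel (κ a i)) (hc : IsCondLaws π (κ a)) :
    (lebCube (Fin d)).map (invRosenblatt (κ a)) = π := by
  refine lebCube_map_invRosenblatt hc ?_ fun (i : Fin d) => ?_
  · exact ((h.continuous_invRosenblatt hκ).comp (Continuous.prodMk_right a)).measurable
  · refine Continuous.measurable (continuous_iff_continuousAt.2 fun p => ?_)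
    refine continuousAt_quantile (ρ := fun p : (Fin (i : ℕ) → UI) × UI => κ a i p.1)
      continuous_snd.continuousAt (fun s => ?_) (h.strictMono _ _ _)
    exact ((h.continuous_cdf i s).comp (continuous_const.prodMk continuous_fst)).continuousAt

/-! ### Half-open boxes and grid cells -/

variable {ι : Type}

/-- The half-open box `∏ [a_i, b_i)`. -/
def halfOpenBox (a b : ι → ℝ) : Set (Cube ι) := {x | ∀ i, a i ≤ x i ∧ (x i : ℝ) < b i}

lemma measurableSet_halfOpenBox [Fintype ι] (a b : ι → ℝ) :
    MeasurableSet (halfOpenBox a b) := by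
  have : halfOpenBox a b = ⋂ i, {x : Cube ι | a i ≤ x i} ∩ {x : Cube ι | (x i : ℝ) < b i} := by
    ext x; simp [halfOpenBox]
  rw [this]
  refine MeasurableSet.iInter fun i => MeasurableSet.inter ?_ ?_
  · exact measurableSet_le measurable_const (by fun_prop)
  · exact measurableSet_lt (by fun_prop) measurable_const

/-- The half-open box, whose faces may lie at `1`, is an increasing union of boxes admitted in the
extreme norm. -/
lemma abs_sub_halfOpenBox_le [Fintype ι] {μ ν : Measure (Cube ι)} [IsFiniteMeasure μ]
    [IsFiniteMeasure ν] {a b : ι → ℝ} (ha : ∀ i, 0 ≤ a i) (hab : ∀ i, a i < b i)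
    (hb : ∀ i, b i ≤ 1) :
    ENNReal.ofReal |μ.real (halfOpenBox a b) - ν.real (halfOpenBox a b)| ≤ extremeNorm μ ν := by
  let A : Cube ι := fun i => ⟨a i, ha i, (hab i).trans_le (hb i)⟩
  have hpos (n : ℕ) : (0 : ℝ) < 1 / ((n : ℝ) + 2) := by positivity
  have hlt (n : ℕ) : (1 : ℝ) / ((n : ℝ) + 2) < 1 := by
    rw [div_lt_one (by positivity)]; linarith [n.cast_nonneg (α := ℝ)]
  -- The `n + 2` in the denominator keeps `a i < β n i` already at `n = 0`, since only nondegenerate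
  -- boxes are admitted.
  let β (n : ℕ) (i : ι) : ℝ := b i - (b i - a i) * (1 / ((n : ℝ) + 2))
  have hβ1 (n i) : a i < β n i := by
    have := sub_pos.2 (hab i)
    have := mul_lt_mul_of_pos_left (hlt n) this
    simp only [β]; linarith
  have hβ2 (n i) : β n i < b i := by
    have := mul_pos (sub_pos.2 (hab i)) (hpos n)
    simp only [β]; linarith
  let B (n : ℕ) : Cube ι := fun i =>
    ⟨β n i, (ha i).trans (hβ1 n i).le, (hβ2 n i).trans_le (hb i)⟩
  have hmono : Monotone fun n => Icc A (B n) := by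
    intro m n hmn
    refine Icc_subset_Icc le_rfl fun i => ?_
    change β m i ≤ β n i
    have h1 : (1 : ℝ) / ((n : ℝ) + 2) ≤ 1 / ((m : ℝ) + 2) := by
      apply one_div_le_one_div_of_le (by positivity)
      have : (m : ℝ) ≤ n := by exact_mod_cast hmn
      linarith
    have := mul_le_mul_of_nonneg_left h1 (sub_pos.2 (hab i)).le
    simp only [β]; linarith
  have hlim (i : ι) : Tendsto (fun n => β n i) atTop (𝓝 (b i)) := by
    have h1 : Tendsto (fun n : ℕ => (1 : ℝ) / ((n : ℝ) + 2)) atTop (𝓝 0) :=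
      tendsto_const_nhds.div_atTop
        (tendsto_atTop_add_const_right _ _ tendsto_natCast_atTop_atTop)
    simpa [β] using (h1.const_mul (b i - a i)).const_sub (b i)
  have hU : ⋃ n, Icc A (B n) = halfOpenBox a b := by
    ext x
    simp only [mem_iUnion]
    constructor
    · rintro ⟨n, hn⟩ i
      exact ⟨hn.1 i, lt_of_le_of_lt (hn.2 i) (hβ2 n i)⟩
    · intro hx
      have : ∀ᶠ n in atTop, ∀ i, (x i : ℝ) < β n i :=
        eventually_all.2 fun i => (hlim i).eventually_const_lt (hx i).2
      obtain ⟨n, hn⟩ := this.exists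
      exact ⟨n, fun i => (hx i).1, fun i => (hn i).le⟩
  have hT (ρ : Measure (Cube ι)) [IsFiniteMeasure ρ] :
      Tendsto (fun n => ρ.real (Icc A (B n))) atTop (𝓝 (ρ.real (halfOpenBox a b))) := by
    have := tendsto_measure_iUnion_atTop (μ := ρ) hmono
    rw [hU] at this
    exact (ENNReal.tendsto_toReal (measure_ne_top _ _)).comp this
  refine le_of_tendsto' (ENNReal.tendsto_ofReal ((hT μ).sub (hT ν)).abs) fun n => ?_
  exact le_iSup_of_le A (le_iSup_of_le (B n) (le_iSup_of_le (fun i => hβ1 n i) le_rfl))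

/-- The cell of `x` in the partition of the cube into `(K + 1)^ι` cells of side `1 / (K + 1)`. -/
noncomputable def gridCell (K : ℕ) (x : Cube ι) : ι → Fin (K + 1) := fun i =>
  ⟨⌊((K : ℝ) + 1) * x i⌋₊, by
    rw [Nat.floor_lt (mul_nonneg (by positivity) (x i).2.1)]
    push_cast
    have := mul_lt_mul_of_pos_left (x i).2.2 (show (0 : ℝ) < (K : ℝ) + 1 by positivity)
    linarith⟩

lemma gridCell_eq_iff {K : ℕ} {x : Cube ι} {c : ι → Fin (K + 1)} :
    gridCell K x = c ↔
      ∀ i, ((c i : ℕ) : ℝ) ≤ ((K : ℝ) + 1) * x i ∧ ((K : ℝ) + 1) * x i < (c i : ℕ) + 1 := by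
  rw [funext_iff]
  refine forall_congr' fun i => ?_
  rw [Fin.ext_iff]
  exact Nat.floor_eq_iff (mul_nonneg (by positivity) (x i).2.1)

lemma gridCell_preimage_eq (K : ℕ) (c : ι → Fin (K + 1)) :
    gridCell K ⁻¹' {c} =
      halfOpenBox (fun i => (c i : ℕ) / ((K : ℝ) + 1)) (fun i => ((c i : ℕ) + 1) / ((K : ℝ) + 1)) := by
  ext x
  have h : (0 : ℝ) < (K : ℝ) + 1 := by positivity
  rw [mem_preimage, mem_singleton_iff, gridCell_eq_iff]
  refine forall_congr' fun i => ?_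
  rw [div_le_iff₀ h, lt_div_iff₀ h, mul_comm]

lemma measurable_gridCell [Fintype ι] (K : ℕ) : Measurable (gridCell K : Cube ι → _) :=
  measurable_to_countable' fun c => by
    rw [gridCell_preimage_eq]; exact measurableSet_halfOpenBox _ _

lemma abs_sub_le_of_gridCell_eq {K : ℕ} {x y : Cube ι} (h : gridCell K x = gridCell K y) (i : ι) :
    |(x i : ℝ) - y i| ≤ 1 / ((K : ℝ) + 1) := by
  have hK : (0 : ℝ) < (K : ℝ) + 1 := by positivity
  have h1 := gridCell_eq_iff.1 h i
  have h2 := gridCell_eq_iff.1 (rfl : gridCell K y = _) i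
  rw [abs_le, neg_le_iff_add_nonneg, ← sub_nonneg (a := 1 / _)]
  constructor <;> refine nonneg_of_mul_nonneg_right (a := (K : ℝ) + 1) ?_ hK <;> field_simp <;>
    linarith

lemma dist_le_of_gridCell_eq [Fintype ι] {K : ℕ} {x y : Cube ι}
    (h : gridCell K x = gridCell K y) : dist x y ≤ 1 / ((K : ℝ) + 1) :=
  (dist_pi_le_iff (by positivity)).2 fun i => abs_sub_le_of_gridCell_eq h i

lemma abs_sub_gridCell_le [Fintype ι] {μ ν : Measure (Cube ι)} [IsFiniteMeasure μ]
    [IsFiniteMeasure ν] (K : ℕ) (c : ι → Fin (K + 1)) :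
    ENNReal.ofReal |μ.real (gridCell K ⁻¹' {c}) - ν.real (gridCell K ⁻¹' {c})| ≤
      extremeNorm μ ν := by
  have hK : (0 : ℝ) < (K : ℝ) + 1 := by positivity
  rw [gridCell_preimage_eq]
  refine abs_sub_halfOpenBox_le (fun i => by positivity) (fun i => ?_) (fun i => ?_)
  · exact (div_lt_div_iff_of_pos_right hK).2 (by linarith)
  · rw [div_le_one hK]
    have : ((c i : ℕ) : ℝ) ≤ K := by exact_mod_cast (c i).is_le
    linarith

/-! ### Integrals of Lipschitz functions -/

lemma abs_integral_sub_gridCell_le [Fintype ι] [DecidableEq ι] {μ : Measure (Cube ι)} [IsFiniteMeasure μ]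
    {g : Cube ι → ℝ} {L : ℝ≥0} (hg : LipschitzWith L g) {M : ℝ} (hM : ∀ x, |g x| ≤ M) (K : ℕ)
    {φ : (ι → Fin (K + 1)) → Cube ι} (hφ : ∀ x, dist x (φ (gridCell K x)) ≤ 1 / ((K : ℝ) + 1)) :
    |∫ x, g x ∂μ - ∑ c, μ.real (gridCell K ⁻¹' {c}) * g (φ c)| ≤
      μ.real univ * (L * (1 / ((K : ℝ) + 1))) := by
  have h1 : ∑ c, μ.real (gridCell K ⁻¹' {c}) * g (φ c) = ∫ x, g (φ (gridCell K x)) ∂μ := by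
    have := integral_map (μ := μ) (measurable_gridCell K).aemeasurable
      (f := fun c => g (φ c)) (Measurable.of_discrete.aestronglyMeasurable)
    rw [← this, integral_fintype Integrable.of_finite]
    refine Finset.sum_congr rfl fun c _ => ?_
    rw [map_measureReal_apply (measurable_gridCell K) (measurableSet_singleton c), smul_eq_mul]
  have i1 : Integrable g μ :=
    Integrable.of_bound hg.continuous.aestronglyMeasurable M (ae_of_all _ hM)
  have i2 : Integrable (fun x => g (φ (gridCell K x))) μ := by
    refine Integrable.of_bound ?_ M (ae_of_all _ fun x => hM _)
    exact (Measurable.of_discrete (f := fun c => g (φ c)) |>.comp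
      (measurable_gridCell K)).aestronglyMeasurable
  rw [h1, ← integral_sub i1 i2, ← Real.norm_eq_abs, mul_comm]
  refine norm_integral_le_of_norm_le_const (ae_of_all _ fun x => ?_)
  rw [← dist_eq_norm]
  exact (hg.dist_le_mul _ _).trans (mul_le_mul_of_nonneg_left (hφ x) L.2)

/-- Freezing `g` at the lower corner of each cell costs its oscillation on a cell; what remains is a
finite sum of differences of cell masses. -/
lemma abs_integral_sub_integral_le [Fintype ι] [DecidableEq ι] {μ ν : Measure (Cube ι)} [IsFiniteMeasure μ]
    [IsFiniteMeasure ν] {g : Cube ι → ℝ} {L : ℝ≥0} (hg : LipschitzWith L g) {M : ℝ}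
    (hM : ∀ x, |g x| ≤ M) (K : ℕ) {δ : ℝ}
    (hδ : ∀ c, |μ.real (gridCell K ⁻¹' {c}) - ν.real (gridCell K ⁻¹' {c})| ≤ δ) :
    |∫ x, g x ∂μ - ∫ x, g x ∂ν| ≤ (μ.real univ + ν.real univ) * (L * (1 / ((K : ℝ) + 1))) +
      Fintype.card (ι → Fin (K + 1)) * (δ * M) := by
  have hK : (0 : ℝ) < (K : ℝ) + 1 := by positivity
  let φ : (ι → Fin (K + 1)) → Cube ι := fun c i =>
    ⟨(c i : ℕ) / ((K : ℝ) + 1), by positivity, by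
      rw [div_lt_one hK]
      have : ((c i : ℕ) : ℝ) ≤ K := by exact_mod_cast (c i).is_le
      linarith⟩
  have hφ (x : Cube ι) : dist x (φ (gridCell K x)) ≤ 1 / ((K : ℝ) + 1) := by
    refine dist_le_of_gridCell_eq (Eq.symm (gridCell_eq_iff.2 fun i => ?_))
    have : ((K : ℝ) + 1) * (φ (gridCell K x) i : ℝ) = ((gridCell K x i : ℕ) : ℝ) := by
      simp only [φ]; field_simp
    rw [this]
    exact ⟨le_rfl, lt_add_one _⟩
  have h1 := abs_le.1 (abs_integral_sub_gridCell_le (μ := μ) hg hM K hφ)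
  have h2 := abs_le.1 (abs_integral_sub_gridCell_le (μ := ν) hg hM K hφ)
  have h3 : |∑ c, μ.real (gridCell K ⁻¹' {c}) * g (φ c) -
      ∑ c, ν.real (gridCell K ⁻¹' {c}) * g (φ c)| ≤
      Fintype.card (ι → Fin (K + 1)) * (δ * M) := by
    rw [← Finset.sum_sub_distrib]
    refine (Finset.abs_sum_le_sum_abs _ _).trans ?_
    refine (Finset.sum_le_card_nsmul _ _ (δ * M) fun c _ => ?_).trans (by simp)
    rw [← sub_mul, abs_mul]
    exact mul_le_mul (hδ c) (hM _) (abs_nonneg _) ((abs_nonneg _).trans (hδ c))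
  have h3 := abs_le.1 h3
  rw [abs_le]
  constructor <;> linarith [h1.1, h1.2, h2.1, h2.2, h3.1, h3.2]

/-- Both sequences may move with `N`: resampling compares with multiples of Lebesgue measure whose
masses need not converge. -/
lemma tendsto_integral_sub_integral [Fintype ι] [DecidableEq ι] {μ ν : ℕ → Measure (Cube ι)}
    [∀ N, IsFiniteMeasure (μ N)] [∀ N, IsFiniteMeasure (ν N)]
    (hμ : ∀ᶠ N in atTop, (μ N).real univ ≤ 1) (hν : ∀ᶠ N in atTop, (ν N).real univ ≤ 1)
    (h : ∀ K : ℕ, ∀ ε > 0, ∀ᶠ N in atTop, ∀ c,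
      |(μ N).real (gridCell K ⁻¹' {c}) - (ν N).real (gridCell K ⁻¹' {c})| ≤ ε)
    {g : Cube ι → ℝ} {L : ℝ≥0} (hg : LipschitzWith L g) {M : ℝ} (hM : ∀ x, |g x| ≤ M) :
    Tendsto (fun N => ∫ x, g x ∂(μ N) - ∫ x, g x ∂(ν N)) atTop (𝓝 0) := by
  rw [Metric.tendsto_nhds]
  intro ε hε
  have h1 : Tendsto (fun K : ℕ => 2 * ((L : ℝ) * (1 / ((K : ℝ) + 1)))) atTop (𝓝 0) := by
    simpa using (tendsto_one_div_add_atTop_nhds_zero_nat.const_mul (L : ℝ)).const_mul 2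
  obtain ⟨K, hK⟩ := (h1.eventually_lt_const (half_pos hε)).exists
  have hM0 : 0 ≤ M := (abs_nonneg _).trans (hM 0)
  -- The `+ 1` keeps `C` positive when `M = 0`.
  let C : ℝ := Fintype.card (ι → Fin (K + 1)) * M + 1
  have hC : 0 < C := by positivity
  filter_upwards [hμ, hν, h K (ε / 2 / C) (by positivity)] with N h1 h2 h3
  have h4 := abs_integral_sub_integral_le hg hM K h3
  rw [Real.dist_eq, sub_zero]
  have h5 : ((μ N).real univ + (ν N).real univ) * (L * (1 / ((K : ℝ) + 1))) ≤
      2 * ((L : ℝ) * (1 / ((K : ℝ) + 1))) :=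
    mul_le_mul_of_nonneg_right (by linarith) (by positivity)
  have h6 : Fintype.card (ι → Fin (K + 1)) * (ε / 2 / C * M) ≤ ε / 2 := by
    have : ε / 2 / C * C = ε / 2 := div_mul_cancel₀ _ hC.ne'
    have h7 : ε / 2 / C * (Fintype.card (ι → Fin (K + 1)) * M) ≤ ε / 2 / C * C :=
      mul_le_mul_of_nonneg_left (by simp [C]) (by positivity)
    linarith
  linarith

/-! ### Weak convergence -/

/-- Weak convergence of a sequence of measures. -/
def WeakConv {X : Type*} [TopologicalSpace X] [MeasurableSpace X] (μ : ℕ → Measure X)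
    (ν : Measure X) : Prop :=
  ∀ g : X → ℝ, Continuous g → (∃ C, ∀ x, |g x| ≤ C) →
    Tendsto (fun N => ∫ x, g x ∂(μ N)) atTop (𝓝 (∫ x, g x ∂ν))

lemma WeakConv.map {X Y : Type*} [TopologicalSpace X] [MeasurableSpace X] [OpensMeasurableSpace X]
    [TopologicalSpace Y] [MeasurableSpace Y] [BorelSpace Y] [SecondCountableTopology Y]
    {μ : ℕ → Measure X} {ν : Measure X}
    (h : WeakConv μ ν) {f : X → Y} (hf : Continuous f) :
    WeakConv (fun N => (μ N).map f) (ν.map f) := by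
  rintro g hg ⟨C, hC⟩
  have e (ρ : Measure X) : ∫ y, g y ∂(ρ.map f) = ∫ x, g (f x) ∂ρ :=
    integral_map hf.measurable.aemeasurable hg.measurable.aestronglyMeasurable
  simp_rw [e]
  exact h _ (hg.comp hf) ⟨C, fun x => hC _⟩

/-- The normalised weights sum to one only for large `N`; replacing the other terms by `ν` gives
access to the topology on `ProbabilityMeasure`. -/
lemma exists_probabilityMeasure_seq {X : Type*} [MeasurableSpace X] {μ : ℕ → Measure X}
    (ν : ProbabilityMeasure X) (hμ : ∀ᶠ N in atTop, IsProbabilityMeasure (μ N)) :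
    ∃ μ' : ℕ → ProbabilityMeasure X, ∀ᶠ N in atTop, (μ' N : Measure X) = μ N := by
  classical
  refine ⟨fun N => if h : IsProbabilityMeasure (μ N) then ⟨μ N, h⟩ else ν, ?_⟩
  filter_upwards [hμ] with N hN
  simp [hN]

lemma weakConv_iff_tendsto {X : Type*} [TopologicalSpace X] [MeasurableSpace X]
    [OpensMeasurableSpace X] {μ : ℕ → Measure X} {ν : ProbabilityMeasure X}
    {μ' : ℕ → ProbabilityMeasure X} (h : ∀ᶠ N in atTop, (μ' N : Measure X) = μ N) :
    WeakConv μ ν ↔ Tendsto μ' atTop (𝓝 ν) := by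
  rw [ProbabilityMeasure.tendsto_iff_forall_integral_tendsto]
  constructor
  · intro hw f
    refine (hw f f.continuous ⟨‖f‖, f.norm_coe_le_norm⟩).congr' ?_
    filter_upwards [h] with N hN
    rw [hN]
  · rintro hw f hf ⟨C, hC⟩
    refine (hw (BoundedContinuousFunction.ofNormedAddCommGroup f hf C hC)).congr' ?_
    filter_upwards [h] with N hN
    rw [hN]; rfl

lemma weakConv_of_lipschitz {X : Type*} [PseudoMetricSpace X] [MeasurableSpace X]
    [OpensMeasurableSpace X] {μ : ℕ → Measure X} {ν : Measure X} [IsProbabilityMeasure ν]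
    (hμ : ∀ᶠ N in atTop, IsProbabilityMeasure (μ N))
    (h : ∀ (g : X → ℝ) (L : ℝ≥0) (M : ℝ), LipschitzWith L g → (∀ x, |g x| ≤ M) →
      Tendsto (fun N => ∫ x, g x ∂(μ N)) atTop (𝓝 (∫ x, g x ∂ν))) :
    WeakConv μ ν := by
  obtain ⟨ν', rfl⟩ : ∃ ν' : ProbabilityMeasure X, (ν' : Measure X) = ν := ⟨⟨ν, inferInstance⟩, rfl⟩
  obtain ⟨μ', hμ'⟩ := exists_probabilityMeasure_seq ν' hμ
  refine (weakConv_iff_tendsto hμ').2 ?_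
  rw [tendsto_iff_forall_lipschitz_integral_tendsto]
  rintro g ⟨C, hC⟩ ⟨L, hL⟩
  have : Nonempty X := nonempty_of_isProbabilityMeasure (ν' : Measure X)
  let x₀ : X := Classical.arbitrary X
  -- The criterion bounds only the oscillation of `g`, by `C`; a bound on `|g|` follows from its
  -- value at one point.
  refine (h g L (|g x₀| + C) hL fun x => ?_).congr' ?_
  · have := hC x x₀
    rw [Real.dist_eq] at this
    have h2 := abs_sub_abs_le_abs_sub (g x) (g x₀)
    linarith
  · filter_upwards [hμ'] with N hN
    rw [hN]

lemma WeakConv.tendsto_measureReal {X : Type*} [PseudoMetricSpace X] [MeasurableSpace X]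
    [BorelSpace X] {μ : ℕ → Measure X} {ν : Measure X} [IsProbabilityMeasure ν]
    (h : WeakConv μ ν) (hμ : ∀ᶠ N in atTop, IsProbabilityMeasure (μ N)) {E : Set X}
    (hE : ν (frontier E) = 0) : Tendsto (fun N => (μ N).real E) atTop (𝓝 (ν.real E)) := by
  obtain ⟨ν', rfl⟩ : ∃ ν' : ProbabilityMeasure X, (ν' : Measure X) = ν := ⟨⟨ν, inferInstance⟩, rfl⟩
  obtain ⟨μ', hμ'⟩ := exists_probabilityMeasure_seq ν' hμ
  have h1 := (weakConv_iff_tendsto hμ').1 h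
  have h2 := ProbabilityMeasure.tendsto_measure_of_null_frontier_of_tendsto' h1 hE
  have h3 := (ENNReal.tendsto_toReal (measure_ne_top _ _)).comp h2
  refine h3.congr' ?_
  filter_upwards [hμ'] with N hN
  simp only [Function.comp]
  rw [hN]; rfl

/-! ### From weak convergence to the extreme norm -/

lemma frontier_gridCell_preimage_subset [Fintype ι] (K : ℕ) (c : ι → Fin (K + 1)) :
    frontier (gridCell K ⁻¹' {c} : Set (Cube ι)) ⊆
      ⋃ i, (fun x : Cube ι => x i) ⁻¹' {s : UI | ((K : ℝ) + 1) * s = (c i : ℕ) ∨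
        ((K : ℝ) + 1) * s = (c i : ℕ) + 1} := by
  have hcont (i : ι) : Continuous fun x : Cube ι => ((K : ℝ) + 1) * (x i : ℝ) := by fun_prop
  have hclosed : IsClosed {x : Cube ι | ∀ i, ((c i : ℕ) : ℝ) ≤ ((K : ℝ) + 1) * x i ∧
      ((K : ℝ) + 1) * x i ≤ (c i : ℕ) + 1} := by
    simp only [ofPred_forall]
    exact isClosed_iInter fun i => (isClosed_le continuous_const (hcont i)).inter
      (isClosed_le (hcont i) continuous_const)
  have hopen : IsOpen {x : Cube ι | ∀ i, ((c i : ℕ) : ℝ) < ((K : ℝ) + 1) * x i ∧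
      ((K : ℝ) + 1) * x i < (c i : ℕ) + 1} := by
    simp only [ofPred_forall]
    exact isOpen_iInter_of_finite fun i => (isOpen_lt continuous_const (hcont i)).inter
      (isOpen_lt (hcont i) continuous_const)
  rintro x ⟨hx1, hx2⟩
  have h1 := closure_minimal (fun y hy i => ⟨(gridCell_eq_iff.1 hy i).1,
    (gridCell_eq_iff.1 hy i).2.le⟩) hclosed hx1
  by_contra hx
  refine hx2 (interior_maximal (fun y hy => gridCell_eq_iff.2 fun i => ⟨(hy i).1.le, (hy i).2⟩)
    hopen fun i => ?_)
  simp only [mem_iUnion, mem_preimage, mem_ofPred_eq, not_exists, not_or] at hx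
  exact ⟨lt_of_le_of_ne (h1 i).1 (Ne.symm (hx i).1), lt_of_le_of_ne (h1 i).2 (hx i).2⟩

lemma lebCube_preimage_eval [Fintype ι] (i : ι) {S : Set UI} (hS : MeasurableSet S) :
    lebCube ι ((fun x : Cube ι => x i) ⁻¹' S) = lebUI S :=
  (measurePreserving_eval (fun _ : ι => lebUI) i).measure_preimage hS.nullMeasurableSet

lemma lebCube_frontier_gridCell_preimage [Fintype ι] (K : ℕ) (c : ι → Fin (K + 1)) :
    lebCube ι (frontier (gridCell K ⁻¹' {c})) = 0 := by
  have hK : (0 : ℝ) < (K : ℝ) + 1 := by positivity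
  have hs (r : ℝ) : lebUI {s : UI | ((K : ℝ) + 1) * s = r} = 0 := by
    rw [lebUI_apply]
    refine measure_mono_null (t := {r / ((K : ℝ) + 1)}) ?_ (by simp)
    rintro _ ⟨s, hs, rfl⟩
    rw [mem_singleton_iff, eq_div_iff hK.ne', mul_comm]; exact hs
  have hm (r : ℝ) : MeasurableSet {s : UI | ((K : ℝ) + 1) * s = r} :=
    measurableSet_eq_fun (measurable_subtype_coe.const_mul _) measurable_const
  refine measure_mono_null (frontier_gridCell_preimage_subset K c) ?_
  refine measure_iUnion_null fun i => ?_
  refine measure_mono_null (preimage_mono (fun s hs => hs) : _ ⊆ (fun x : Cube ι => x i) ⁻¹'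
    ({s : UI | ((K : ℝ) + 1) * s = (c i : ℕ)} ∪ {s : UI | ((K : ℝ) + 1) * s = (c i : ℕ) + 1})) ?_
  rw [preimage_union]
  exact measure_union_null (by rw [lebCube_preimage_eval i (hm _), hs])
    (by rw [lebCube_preimage_eval i (hm _), hs])

lemma lebCube_slab_le [Fintype ι] (i : ι) (a : ℝ) {ε : ℝ} :
    lebCube ι {x | |(x i : ℝ) - a| ≤ ε} ≤ ENNReal.ofReal (2 * ε) := by
  have hm : MeasurableSet {x : UI | |(x : ℝ) - a| ≤ ε} :=
    measurableSet_le (by fun_prop) measurable_const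
  exact (lebCube_preimage_eval i hm).trans_le (lebUI_abs_sub_le a)

lemma measureReal_gridCell_preimage [Fintype ι] (μ : Measure (Cube ι)) [IsFiniteMeasure μ] (K : ℕ)
    (S : Finset (ι → Fin (K + 1))) :
    μ.real (gridCell K ⁻¹' S) = ∑ c ∈ S, μ.real (gridCell K ⁻¹' {c}) := by
  rw [← map_measureReal_apply (measurable_gridCell K) S.measurableSet,
    ← sum_measureReal_singleton]
  exact Finset.sum_congr rfl fun c _ =>
    map_measureReal_apply (measurable_gridCell K) (measurableSet_singleton c)

/-- The box lies between the union of the cells inside it and the union of the cells meeting it. The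
difference is covered, in each coordinate, by two slabs of width `2 / (K + 1)`, whence the `4`; the
bound does not depend on the box. -/
lemma abs_sub_Icc_le [Fintype ι] [DecidableEq ι] {μ ν : Measure (Cube ι)} [IsFiniteMeasure μ] [IsFiniteMeasure ν]
    {C : ℝ≥0} (hν : ν ≤ (C : ℝ≥0∞) • lebCube ι) (K : ℕ) (a b : Cube ι) :
    |μ.real (Icc a b) - ν.real (Icc a b)| ≤
      ∑ c, |μ.real (gridCell K ⁻¹' {c}) - ν.real (gridCell K ⁻¹' {c})| +
        C * (Fintype.card ι * (4 * (1 / ((K : ℝ) + 1)))) := by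
  classical
  let I : Finset (ι → Fin (K + 1)) := Finset.univ.filter fun c => gridCell K ⁻¹' {c} ⊆ Icc a b
  let O : Finset (ι → Fin (K + 1)) :=
    Finset.univ.filter fun c => ∃ y ∈ Icc a b, gridCell K y = c
  have hI : gridCell K ⁻¹' I ⊆ Icc a b := by
    intro x hx
    have hx' : gridCell K x ∈ I := hx
    exact (Finset.mem_filter.1 hx').2 rfl
  have hO : Icc a b ⊆ gridCell K ⁻¹' O := by
    intro x hx
    have : gridCell K x ∈ O := Finset.mem_filter.2 ⟨Finset.mem_univ _, x, hx, rfl⟩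
    exact this
  have hmI : MeasurableSet (gridCell K ⁻¹' (I : Set (ι → Fin (K + 1)))) :=
    measurable_gridCell K I.measurableSet
  have hdiff (S : Finset (ι → Fin (K + 1))) :
      |μ.real (gridCell K ⁻¹' S) - ν.real (gridCell K ⁻¹' S)| ≤
        ∑ c, |μ.real (gridCell K ⁻¹' {c}) - ν.real (gridCell K ⁻¹' {c})| := by
    rw [measureReal_gridCell_preimage, measureReal_gridCell_preimage, ← Finset.sum_sub_distrib]
    exact (Finset.abs_sum_le_sum_abs _ _).trans
      (Finset.sum_le_sum_of_subset_of_nonneg (Finset.subset_univ _) fun _ _ _ => abs_nonneg _)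
  -- Such an `x` shares its cell with a point `y` of the box and a point `z` outside; the face
  -- separating `z` from `y` is within one cell side of `x`.
  have hsub : gridCell K ⁻¹' O \ gridCell K ⁻¹' I ⊆
      ⋃ i, ({x : Cube ι | |(x i : ℝ) - a i| ≤ 1 / ((K : ℝ) + 1)} ∪
        {x : Cube ι | |(x i : ℝ) - b i| ≤ 1 / ((K : ℝ) + 1)}) := by
    rintro x ⟨hxO, hxI⟩
    have hxO' : gridCell K x ∈ O := hxO
    obtain ⟨y, hy, hxy⟩ := (Finset.mem_filter.1 hxO').2
    have hxI' : gridCell K x ∉ I := hxI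
    simp only [I, Finset.mem_filter, Finset.mem_univ, true_and] at hxI'
    obtain ⟨z, hz, hzB⟩ := not_subset.1 hxI'
    have hz' : gridCell K z = gridCell K x := hz
    rw [mem_Icc, Pi.le_def, Pi.le_def, ← forall_and, not_forall] at hzB
    obtain ⟨i, hi⟩ := hzB
    refine mem_iUnion.2 ⟨i, ?_⟩
    have e1 := abs_le.1 (abs_sub_le_of_gridCell_eq hxy i)
    have e2 := abs_le.1 (abs_sub_le_of_gridCell_eq hz' i)
    have y1 : (a i : ℝ) ≤ y i := hy.1 i
    have y2 : (y i : ℝ) ≤ b i := hy.2 i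
    rcases not_and_or.1 hi with h | h
    · left
      have h : (z i : ℝ) < a i := not_le.1 h
      change |(x i : ℝ) - a i| ≤ 1 / ((K : ℝ) + 1)
      exact abs_le.2 ⟨by linarith, by linarith⟩
    · right
      have h : (b i : ℝ) < z i := not_le.1 h
      change |(x i : ℝ) - b i| ≤ 1 / ((K : ℝ) + 1)
      exact abs_le.2 ⟨by linarith, by linarith⟩
  have hsmall : ν.real (gridCell K ⁻¹' O \ gridCell K ⁻¹' I) ≤
      C * (Fintype.card ι * (4 * (1 / ((K : ℝ) + 1)))) := by
    refine ENNReal.toReal_le_of_le_ofReal (by positivity) ?_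
    refine (measure_mono hsub).trans ((measure_iUnion_fintype_le _ _).trans ?_)
    have h1 (i : ι) : ν ({x : Cube ι | |(x i : ℝ) - a i| ≤ 1 / ((K : ℝ) + 1)} ∪
        {x : Cube ι | |(x i : ℝ) - b i| ≤ 1 / ((K : ℝ) + 1)}) ≤
        ENNReal.ofReal (C * (4 * (1 / ((K : ℝ) + 1)))) := by
      refine (hν _).trans ?_
      rw [Measure.smul_apply, smul_eq_mul, ENNReal.ofReal_mul C.coe_nonneg, ENNReal.ofReal_coe_nnreal]
      refine mul_le_mul_right ((measure_union_le _ _).trans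
        ((add_le_add (lebCube_slab_le i _) (lebCube_slab_le i _)).trans ?_)) _
      rw [← ENNReal.ofReal_add (by positivity) (by positivity)]
      exact ENNReal.ofReal_le_ofReal (by linarith)
    refine (Finset.sum_le_card_nsmul _ _ _ fun i _ => h1 i).trans ?_
    rw [nsmul_eq_mul, ← ENNReal.ofReal_natCast, ← ENNReal.ofReal_mul (by positivity)]
    exact ENNReal.ofReal_le_ofReal (by rw [Finset.card_univ]; exact le_of_eq (by ring))
  have hOI : ν.real (gridCell K ⁻¹' O) =
      ν.real (gridCell K ⁻¹' I) + ν.real (gridCell K ⁻¹' O \ gridCell K ⁻¹' I) := by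
    rw [measureReal_sdiff (hI.trans hO) hmI]; ring
  have m1 := measureReal_mono (μ := μ) hI
  have m2 := measureReal_mono (μ := μ) hO
  have n1 := measureReal_mono (μ := ν) hI
  have n2 := measureReal_mono (μ := ν) hO
  have d1 := abs_le.1 (hdiff I)
  have d2 := abs_le.1 (hdiff O)
  rw [abs_le]
  constructor <;> linarith [d1.1, d1.2, d2.1, d2.2]

/-- First `K` is chosen to make the slab term small, then `N` to make the finitely many cell masses
close, which the null boundaries of the cells allow. -/
lemma WeakConv.tendsto_extremeNorm [Fintype ι] [DecidableEq ι] {μ : ℕ → Measure (Cube ι)} {ν : Measure (Cube ι)}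
    [IsProbabilityMeasure ν] (h : WeakConv μ ν)
    (hμ : ∀ᶠ N in atTop, IsProbabilityMeasure (μ N)) {C : ℝ≥0}
    (hν : ν ≤ (C : ℝ≥0∞) • lebCube ι) :
    Tendsto (fun N => extremeNorm (μ N) ν) atTop (𝓝 0) := by
  have hcell (K : ℕ) : Tendsto (fun N => ∑ c, |(μ N).real (gridCell K ⁻¹' {c}) -
      ν.real (gridCell K ⁻¹' {c})|) atTop (𝓝 0) := by
    have h0 : ∑ _c : ι → Fin (K + 1), (0 : ℝ) = 0 := Finset.sum_const_zero
    refine Eq.subst (motive := fun r : ℝ => Tendsto _ atTop (𝓝 r)) h0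
      (tendsto_finsetSum _ fun c _ => ?_)
    have hf : ν (frontier (gridCell K ⁻¹' {c})) = 0 :=
      le_antisymm ((hν _).trans (by
        rw [Measure.smul_apply, lebCube_frontier_gridCell_preimage, smul_zero])) bot_le
    simpa using ((h.tendsto_measureReal hμ hf).sub_const (ν.real (gridCell K ⁻¹' {c}))).abs
  rw [ENNReal.tendsto_nhds_zero]
  intro ε hε
  rcases eq_or_ne ε ∞ with rfl | hε'
  · simp
  have hε0 : 0 < ε.toReal := ENNReal.toReal_pos hε.ne' hε'
  have h1 : Tendsto (fun K : ℕ => (C : ℝ) * (Fintype.card ι * (4 * (1 / ((K : ℝ) + 1)))))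
      atTop (𝓝 0) := by
    simpa using ((tendsto_one_div_add_atTop_nhds_zero_nat.const_mul (4 : ℝ)).const_mul
      (Fintype.card ι : ℝ)).const_mul (C : ℝ)
  obtain ⟨K, hK⟩ := (h1.eventually_lt_const (half_pos hε0)).exists
  filter_upwards [hμ, (hcell K).eventually_lt_const (half_pos hε0)] with N h1 h2
  refine iSup_le fun a => iSup_le fun b => iSup_le fun _ => ?_
  rw [← ENNReal.ofReal_toReal hε']
  exact ENNReal.ofReal_le_ofReal ((abs_sub_Icc_le hν K a b).trans (by linarith))

/-! ### Weighted empirical measures -/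

section WeightedEmpirical

variable {E : Type} [MeasurableSpace E] {N : ℕ} (w : Fin N → ℝ≥0) (x : Fin N → E)

instance isFiniteMeasure_weightedEmpirical : IsFiniteMeasure (weightedEmpirical w x) := by
  have (n : Fin N) : IsFiniteMeasure ((w n : ℝ≥0∞) • Measure.dirac (x n)) :=
    inferInstanceAs (IsFiniteMeasure (w n • Measure.dirac (x n)))
  unfold weightedEmpirical; infer_instance

lemma integral_weightedEmpirical [MeasurableSingletonClass E] (f : E → ℝ) :
    ∫ y, f y ∂(weightedEmpirical w x) = ∑ n, (w n : ℝ) * f (x n) := by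
  unfold weightedEmpirical
  rw [integral_finsetSum_measure fun n _ => ?_]
  · simp [NNReal.smul_def]
  · exact (integrable_dirac (by simp)).smul_measure (by simp)

lemma measureReal_weightedEmpirical {S : Set E} (hS : MeasurableSet S) :
    (weightedEmpirical w x).real S = ∑ n, (w n : ℝ) * S.indicator 1 (x n) := by
  simp only [weightedEmpirical, Measure.real, Measure.finsetSum_apply, Measure.smul_apply,
    Measure.dirac_apply' _ hS, smul_eq_mul]
  rw [ENNReal.toReal_sum fun n _ => ?_]
  · refine Finset.sum_congr rfl fun n _ => ?_
    by_cases h : x n ∈ S <;> simp [h]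
  · by_cases h : x n ∈ S <;> simp [h]

lemma measureReal_weightedEmpirical_univ :
    (weightedEmpirical w x).real univ = ∑ n, (w n : ℝ) := by
  simp [measureReal_weightedEmpirical]

variable {w} in
lemma isProbabilityMeasure_weightedEmpirical (hw : ∑ n, w n = 1) :
    IsProbabilityMeasure (weightedEmpirical w x) := by
  constructor
  rw [weightedEmpirical, Measure.finsetSum_apply]
  simp only [Measure.smul_apply, measure_univ, smul_eq_mul, mul_one]
  exact_mod_cast hw

lemma map_weightedEmpirical {F : Type} [MeasurableSpace F] {f : E → F} (hf : Measurable f) :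
    (weightedEmpirical w x).map f = weightedEmpirical w (fun n => f (x n)) := by
  ext s hs
  rw [Measure.map_apply hf hs]
  simp only [weightedEmpirical, Measure.finsetSum_apply, Measure.smul_apply,
    Measure.dirac_apply' _ hs, Measure.dirac_apply' _ (hf hs)]
  rfl

end WeightedEmpirical

lemma sum_inv_card {N : ℕ} (hN : N ≠ 0) : ∑ _n : Fin N, (N : ℝ≥0)⁻¹ = 1 := by
  rw [Finset.sum_const, Finset.card_univ, Fintype.card_fin, nsmul_eq_mul,
    mul_inv_cancel₀ (by exact_mod_cast hN)]

/-! ### Resampling along a sorted key -/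

/-- The last index has cumulative weight `1 ≥ u`, so the default branch is never taken. -/
lemma invIndex_spec {N : ℕ} {w : Fin N → ℝ≥0} (hw : ∑ n, w n = 1) (u : UI) (i₀ : Fin N) :
    (u : ℝ) ≤ ((∑ i ∈ Finset.Iic (invIndex w u i₀), w i : ℝ≥0) : ℝ) ∧
      ∀ k, (u : ℝ) ≤ ((∑ i ∈ Finset.Iic k, w i : ℝ≥0) : ℝ) → invIndex w u i₀ ≤ k := by
  classical
  have hne : (Finset.univ.filter
      (fun k : Fin N => (u : ℝ) ≤ ((∑ i ∈ Finset.Iic k, w i : ℝ≥0) : ℝ))).Nonempty := by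
    have : NeZero N := ⟨fun h => by subst h; exact i₀.elim0⟩
    refine ⟨⊤, Finset.mem_filter.2 ⟨Finset.mem_univ _, ?_⟩⟩
    rw [Finset.Iic_top, hw]
    exact u.2.2.le
  have e : invIndex w u i₀ = Finset.min' _ hne := by
    unfold invIndex
    rw [dif_pos]
  rw [e]
  exact ⟨(Finset.mem_filter.1 (Finset.min'_mem _ hne)).2,
    fun k hk => Finset.min'_le _ k (Finset.mem_filter.2 ⟨Finset.mem_univ _, hk⟩)⟩

/-- The index obtained by inverting at `u` the distribution function of the weights `w`, the
indices being sorted by increasing values of the key `s`. -/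
noncomputable def ancestor {N : ℕ} (w : Fin N → ℝ≥0) (s : Fin N → unitInterval) (u : UI)
    (i₀ : Fin N) : Fin N :=
  Tuple.sort s (invIndex (fun i => w (Tuple.sort s i)) u i₀)

open Classical in
/-- The total weight of the indices whose key belongs to `A`. -/
noncomputable def keyWeight {N : ℕ} (w : Fin N → ℝ≥0) (s : Fin N → unitInterval)
    (A : Set unitInterval) : ℝ≥0 :=
  ∑ i, if s i ∈ A then w i else 0

lemma keyWeight_le_one {N : ℕ} {w : Fin N → ℝ≥0} (hw : ∑ n, w n = 1) (s : Fin N → unitInterval)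
    (A : Set unitInterval) : keyWeight w s A ≤ 1 := by
  classical
  rw [← hw]
  refine Finset.sum_le_sum fun i _ => ?_
  split_ifs <;> simp

/-- In sorted order the indices with key in `A` form an initial segment, whose cumulative weight is
`keyWeight w s A`. Nonemptiness is needed for `u = 0`: if no key lies in `A`, the right side still
holds there. -/
lemma ancestor_mem_iff {N : ℕ} {w : Fin N → ℝ≥0} (hw : ∑ n, w n = 1) {s : Fin N → unitInterval}
    {A : Set unitInterval} (hA : IsLowerSet A) (hne : ∃ i, s i ∈ A) (u : UI) (i₀ : Fin N) :
    s (ancestor w s u i₀) ∈ A ↔ (u : ℝ) ≤ keyWeight w s A := by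
  classical
  set σ := Tuple.sort s with hσ
  have hmono : Monotone (s ∘ σ) := Tuple.monotone_sort s
  have hw' : ∑ i, w (σ i) = 1 := by rw [Equiv.sum_comp σ w, hw]
  have hp : keyWeight w s A = ∑ i ∈ Finset.univ.filter (fun i => s (σ i) ∈ A), w (σ i) := by
    rw [keyWeight, Finset.sum_filter]
    exact (Equiv.sum_comp σ fun i => if s i ∈ A then w i else 0).symm
  obtain ⟨h1, h2⟩ := invIndex_spec hw' u i₀
  set m := invIndex (fun i => w (σ i)) u i₀
  change s (σ m) ∈ A ↔ _
  constructor
  · intro hm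
    refine h1.trans (NNReal.coe_le_coe.2 ?_)
    rw [hp]
    refine Finset.sum_le_sum_of_subset fun i hi => ?_
    exact Finset.mem_filter.2 ⟨Finset.mem_univ _, hA (hmono (Finset.mem_Iic.1 hi)) hm⟩
  · intro hu
    have hne' : (Finset.univ.filter (fun i => s (σ i) ∈ A)).Nonempty := by
      obtain ⟨i, hi⟩ := hne
      exact ⟨σ.symm i, by simpa using hi⟩
    set j := Finset.max' _ hne' with hj
    have hjA : s (σ j) ∈ A := (Finset.mem_filter.1 (Finset.max'_mem _ hne')).2
    have hle : (u : ℝ) ≤ ((∑ i ∈ Finset.Iic j, w (σ i) : ℝ≥0) : ℝ) := by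
      refine hu.trans (NNReal.coe_le_coe.2 ?_)
      rw [hp]
      exact Finset.sum_le_sum_of_subset fun i hi => Finset.mem_Iic.2 (Finset.le_max' _ _ hi)
    exact hA (hmono (h2 j hle)) hjA

/-! ### Slices of the input points -/

lemma lebCube_halfOpenBox {ι : Type} [Fintype ι] {a b : ι → ℝ} (ha : ∀ i, 0 ≤ a i)
    (hab : ∀ i, a i ≤ b i) (hb : ∀ i, b i ≤ 1) :
    (lebCube ι).real (halfOpenBox a b) = ∏ i, (b i - a i) := by
  have e : halfOpenBox a b = univ.pi fun i => {s : UI | a i ≤ s ∧ (s : ℝ) < b i} := by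
    ext x; simp [halfOpenBox]
  rw [e, lebCube, Measure.real, Measure.pi_pi, ENNReal.toReal_prod]
  refine Finset.prod_congr rfl fun i _ => ?_
  have : (Subtype.val : UI → ℝ) '' {s : UI | a i ≤ s ∧ (s : ℝ) < b i} = Ico (a i) (b i) := by
    ext y; constructor
    · rintro ⟨s, hs, rfl⟩; exact hs
    · intro hy; exact ⟨⟨y, (ha i).trans hy.1, hy.2.trans_le (hb i)⟩, hy, rfl⟩
  rw [lebUI_apply, this, Real.volume_Ico, ENNReal.toReal_ofReal (sub_nonneg.2 (hab i))]

lemma measurable_finTail {d : ℕ} :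
    Measurable (Fin.tail : Cube (Fin (d + 1)) → State d) :=
  measurable_pi_lambda _ fun j => measurable_pi_apply j.succ

/-- The slice is closed in its first coordinate, so it is approached from outside by half-open
boxes, uniformly covering `p = 0` and `p = 1`. -/
lemma abs_sub_slice_le {d : ℕ} {μ : Measure (Cube (Fin (d + 1)))} [IsFiniteMeasure μ]
    {a b : Fin d → ℝ} (ha : ∀ i, 0 ≤ a i) (hab : ∀ i, a i < b i) (hb : ∀ i, b i ≤ 1)
    {p : ℝ} (hp0 : 0 ≤ p) (hp1 : p ≤ 1) :
    ENNReal.ofReal |μ.real {w | (w 0 : ℝ) ≤ p ∧ (Fin.tail w : State d) ∈ halfOpenBox a b} -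
      p * (lebCube (Fin d)).real (halfOpenBox a b)| ≤ extremeNorm μ (lebCube _) := by
  have hpos (n : ℕ) : (0 : ℝ) < 1 / ((n : ℝ) + 1) := by positivity
  have hle (n : ℕ) : (1 : ℝ) / ((n : ℝ) + 1) ≤ 1 := by
    rw [div_le_one (by positivity)]; linarith [n.cast_nonneg (α := ℝ)]
  -- This decreases to `p` while staying in `(0, 1]`; for `p = 1` it is constant and imposes
  -- nothing, as `w 0 < 1`.
  let β (n : ℕ) : ℝ := p + (1 - p) * (1 / ((n : ℝ) + 1))
  have hβ0 (n) : 0 < β n := by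
    rcases hp0.eq_or_lt with h | h
    · simp only [β, ← h]; have := hpos n; linarith
    · have := mul_nonneg (sub_nonneg.2 hp1) (hpos n).le
      simp only [β]; linarith
  have hβ1 (n) : β n ≤ 1 := by
    have := mul_le_mul_of_nonneg_left (hle n) (sub_nonneg.2 hp1)
    simp only [β]; linarith
  have hlim : Tendsto β atTop (𝓝 p) := by
    simpa [β] using (tendsto_one_div_add_atTop_nhds_zero_nat.const_mul (1 - p)).const_add p
  let S (n : ℕ) : Set (Cube (Fin (d + 1))) := halfOpenBox (Fin.cons 0 a) (Fin.cons (β n) b)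
  have hmem (n) (w : Cube (Fin (d + 1))) :
      w ∈ S n ↔ (w 0 : ℝ) < β n ∧ (Fin.tail w : State d) ∈ halfOpenBox a b := by
    simp only [S, halfOpenBox, mem_ofPred_eq, Fin.forall_fin_succ, Fin.cons_zero, Fin.cons_succ]
    exact and_congr_left fun _ => and_iff_right (w 0).2.1
  have hanti : Antitone S := by
    intro m n hmn w hw
    rw [hmem] at hw ⊢
    refine ⟨hw.1.trans_le ?_, hw.2⟩
    have h1 : (1 : ℝ) / ((n : ℝ) + 1) ≤ 1 / ((m : ℝ) + 1) := by
      apply one_div_le_one_div_of_le (by positivity)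
      have : (m : ℝ) ≤ n := by exact_mod_cast hmn
      linarith
    have := mul_le_mul_of_nonneg_left h1 (sub_nonneg.2 hp1)
    simp only [β]; linarith
  have hInter : ⋂ n, S n = {w | (w 0 : ℝ) ≤ p ∧ (Fin.tail w : State d) ∈ halfOpenBox a b} := by
    ext w
    simp only [mem_iInter, hmem, mem_ofPred_eq, forall_and, forall_const]
    refine and_congr_left fun _ => Iff.intro (fun h => ge_of_tendsto' hlim fun n => (h n).le) (fun h n => ?_)
    rcases hp1.eq_or_lt with h' | h'
    · simp only [β, h']
      simpa using (w 0).2.2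
    · have := mul_pos (sub_pos.2 h') (hpos n)
      simp only [β]; linarith
  have hT : Tendsto (fun n => μ.real (S n)) atTop
      (𝓝 (μ.real {w | (w 0 : ℝ) ≤ p ∧ (Fin.tail w : State d) ∈ halfOpenBox a b})) := by
    have := tendsto_measure_iInter_atTop (μ := μ)
      (fun n => (measurableSet_halfOpenBox _ _ : MeasurableSet (S n)).nullMeasurableSet) hanti
      ⟨0, measure_ne_top _ _⟩
    rw [hInter] at this
    exact (ENNReal.tendsto_toReal (measure_ne_top _ _)).comp this
  have hc0 : ∀ i, 0 ≤ (Fin.cons 0 a : Fin (d + 1) → ℝ) i := by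
    simpa [Fin.forall_fin_succ] using ha
  have hc1 (n) : ∀ i, (Fin.cons 0 a : Fin (d + 1) → ℝ) i < (Fin.cons (β n) b : _ → ℝ) i := by
    simpa [Fin.forall_fin_succ, hβ0 n] using hab
  have hc2 (n) : ∀ i, (Fin.cons (β n) b : Fin (d + 1) → ℝ) i ≤ 1 := by
    simpa [Fin.forall_fin_succ, hβ1 n] using hb
  have hS (n) : (lebCube _).real (S n) = β n * (lebCube (Fin d)).real (halfOpenBox a b) := by
    rw [lebCube_halfOpenBox hc0 (fun i => (hc1 n i).le) (hc2 n),
      lebCube_halfOpenBox ha (fun i => (hab i).le) hb, Fin.prod_univ_succ]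
    simp
  refine le_of_tendsto' (ENNReal.tendsto_ofReal
    (hT.sub (hlim.mul_const ((lebCube (Fin d)).real (halfOpenBox a b)))).abs) fun n => ?_
  rw [← hS]
  exact abs_sub_halfOpenBox_le hc0 (hc1 n) (hc2 n)

open Classical in
/-- The empirical measure of the points `v n` for which the key of the `n`-th resampled index
belongs to `A`. -/
noncomputable def resampledPart {d N : ℕ} (w : Fin N → ℝ≥0) (s : Fin N → unitInterval)
    (u : Fin N → Cube (Fin (d + 1))) (A : Set unitInterval) : Measure (State d) :=
  weightedEmpirical (fun n => if s (ancestor w s (u n 0) n) ∈ A then (N : ℝ≥0)⁻¹ else 0)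
    (fun n => Fin.tail (u n))

instance {d N : ℕ} (w : Fin N → ℝ≥0) (s : Fin N → unitInterval)
    (u : Fin N → Cube (Fin (d + 1))) (A : Set unitInterval) :
    IsFiniteMeasure (resampledPart w s u A) := by
  unfold resampledPart; infer_instance

/-- By `ancestor_mem_iff` the resampled mass is the empirical mass of a slice of height `keyWeight w
s A`. If no key lies in `A`, both terms vanish. -/
lemma abs_resampledPart_sub_le {d N : ℕ} {w : Fin N → ℝ≥0} (hw : ∑ n, w n = 1)
    (s : Fin N → unitInterval) (u : Fin N → Cube (Fin (d + 1))) {A : Set unitInterval}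
    (hA : IsLowerSet A) {a b : Fin d → ℝ} (ha : ∀ i, 0 ≤ a i) (hab : ∀ i, a i < b i)
    (hb : ∀ i, b i ≤ 1) :
    ENNReal.ofReal |(resampledPart w s u A).real (halfOpenBox a b) -
      keyWeight w s A * (lebCube (Fin d)).real (halfOpenBox a b)| ≤ discrepancy u := by
  classical
  by_cases hne : ∃ i, s i ∈ A
  · have h := abs_sub_slice_le (μ := weightedEmpirical (fun _ => (N : ℝ≥0)⁻¹) u) ha hab hb
      (keyWeight w s A).coe_nonneg (keyWeight_le_one hw s A)
    refine le_of_eq_of_le (congrArg (fun r => ENNReal.ofReal |r - _|) ?_) h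
    have hm0 : MeasurableSet {v : Cube (Fin (d + 1)) | (v 0 : ℝ) ≤ keyWeight w s A} :=
      measurableSet_le (by fun_prop) measurable_const
    have hm := hm0.inter (measurable_finTail (measurableSet_halfOpenBox a b))
    rw [resampledPart, measureReal_weightedEmpirical _ _ (measurableSet_halfOpenBox a b)]
    refine Eq.trans ?_ (measureReal_weightedEmpirical _ _ hm).symm
    refine Finset.sum_congr rfl fun n _ => ?_
    have e := ancestor_mem_iff hw hA hne (u n 0) n
    by_cases h1 : s (ancestor w s (u n 0) n) ∈ A
    · simp [h1, indicator, e.1 h1]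
    · simp [h1, indicator, mt e.2 h1]
  · push Not at hne
    simp [resampledPart, keyWeight, hne, weightedEmpirical]

lemma measureReal_resampledPart_sdiff {d N : ℕ} (w : Fin N → ℝ≥0) (s : Fin N → unitInterval)
    (u : Fin N → Cube (Fin (d + 1))) {A B : Set unitInterval} (hAB : A ⊆ B) {S : Set (State d)}
    (hS : MeasurableSet S) :
    (resampledPart w s u (B \ A)).real S =
      (resampledPart w s u B).real S - (resampledPart w s u A).real S := by
  classical
  simp only [resampledPart, measureReal_weightedEmpirical _ _ hS]
  rw [← Finset.sum_sub_distrib]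
  refine Finset.sum_congr rfl fun n _ => ?_
  by_cases hA : s (ancestor w s (u n 0) n) ∈ A
  · simp [hA, hAB hA]
  · by_cases hB : s (ancestor w s (u n 0) n) ∈ B <;> simp [hA, hB]

lemma keyWeight_sdiff {N : ℕ} (w : Fin N → ℝ≥0) (s : Fin N → unitInterval)
    {A B : Set unitInterval} (hAB : A ⊆ B) :
    (keyWeight w s (B \ A) : ℝ) = keyWeight w s B - keyWeight w s A := by
  classical
  simp only [keyWeight, NNReal.coe_sum]
  rw [← Finset.sum_sub_distrib]
  refine Finset.sum_congr rfl fun n _ => ?_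
  by_cases hA : s n ∈ A
  · simp [hA, hAB hA]
  · by_cases hB : s n ∈ B <;> simp [hA, hB]

/-- An interval of keys is a difference of two lower sets, each costing one discrepancy. -/
lemma abs_resampledPart_sdiff_sub_le {d N : ℕ} {w : Fin N → ℝ≥0} (hw : ∑ n, w n = 1)
    (s : Fin N → unitInterval) (u : Fin N → Cube (Fin (d + 1))) {A B : Set unitInterval}
    (hA : IsLowerSet A) (hB : IsLowerSet B) (hAB : A ⊆ B) (K : ℕ) (c : Fin d → Fin (K + 1)) :
    ENNReal.ofReal |(resampledPart w s u (B \ A)).real (gridCell K ⁻¹' {c}) -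
      keyWeight w s (B \ A) * (lebCube (Fin d)).real (gridCell K ⁻¹' {c})| ≤
        2 * discrepancy u := by
  have hK : (0 : ℝ) < (K : ℝ) + 1 := by positivity
  have h (A : Set unitInterval) (hA : IsLowerSet A) := abs_resampledPart_sub_le hw s u hA
    (a := fun i => (c i : ℕ) / ((K : ℝ) + 1)) (b := fun i => ((c i : ℕ) + 1) / ((K : ℝ) + 1))
    (fun i => by positivity) (fun i => (div_lt_div_iff_of_pos_right hK).2 (by linarith))
    (fun i => (div_le_one hK).2 (by
      have : ((c i : ℕ) : ℝ) ≤ K := by exact_mod_cast (c i).is_le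
      linarith))
  rw [gridCell_preimage_eq, measureReal_resampledPart_sdiff w s u hAB
    (measurableSet_halfOpenBox _ _), keyWeight_sdiff w s hAB, two_mul]
  refine le_trans ?_ (add_le_add (h B hB) (h A hA))
  rw [← ENNReal.ofReal_add (abs_nonneg _) (abs_nonneg _)]
  refine ENNReal.ofReal_le_ofReal ?_
  refine le_trans (le_of_eq ?_) (abs_sub _ _)
  congr 1
  ring

lemma tendsto_integral_resampledPart {d : ℕ} {w : (N : ℕ) → Fin N → ℝ≥0}
    (hw : ∀ᶠ N in atTop, ∑ n, w N n = 1) (s : (N : ℕ) → Fin N → unitInterval)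
    {u : (N : ℕ) → Fin N → Cube (Fin (d + 1))}
    (hu : Tendsto (fun N => discrepancy (u N)) atTop (𝓝 0)) {A B : Set unitInterval}
    (hA : IsLowerSet A) (hB : IsLowerSet B) (hAB : A ⊆ B) {g : State d → ℝ} {L : ℝ≥0}
    (hg : LipschitzWith L g) {M : ℝ} (hM : ∀ x, |g x| ≤ M) :
    Tendsto (fun N => ∫ v, g v ∂(resampledPart (w N) (s N) (u N) (B \ A)) -
      keyWeight (w N) (s N) (B \ A) * ∫ v, g v ∂(lebCube (Fin d))) atTop (𝓝 0) := by
  classical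
  have (N : ℕ) : IsFiniteMeasure
      (((keyWeight (w N) (s N) (B \ A) : ℝ≥0) : ℝ≥0∞) • lebCube (Fin d)) :=
    inferInstanceAs (IsFiniteMeasure (keyWeight (w N) (s N) (B \ A) • lebCube (Fin d)))
  have h := tendsto_integral_sub_integral
    (μ := fun N => resampledPart (w N) (s N) (u N) (B \ A))
    (ν := fun N => ((keyWeight (w N) (s N) (B \ A) : ℝ≥0) : ℝ≥0∞) • lebCube (Fin d))
    ?_ ?_ ?_ hg hM
  · refine h.congr fun N => ?_
    rw [integral_smul_measure]; rfl
  · refine Eventually.of_forall fun N => ?_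
    rw [resampledPart, measureReal_weightedEmpirical_univ]
    rcases eq_or_ne N 0 with rfl | hN
    · simp
    · refine (Finset.sum_le_sum fun n _ => ?_).trans
        (by exact_mod_cast (sum_inv_card hN).le : ∑ _n : Fin N, (((N : ℝ≥0)⁻¹ : ℝ≥0) : ℝ) ≤ 1)
      split_ifs <;> simp
  · filter_upwards [hw] with N hN
    simpa using NNReal.coe_le_coe.2 (keyWeight_le_one hN (s N) (B \ A))
  · intro K ε hε
    have h2 : Tendsto (fun N => 2 * discrepancy (u N)) atTop (𝓝 0) := by
      simpa using ENNReal.Tendsto.const_mul hu (Or.inr (by simp : (2 : ℝ≥0∞) ≠ ∞))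
    filter_upwards [hw, h2.eventually_le_const (ENNReal.ofReal_pos.2 hε)] with N hN h3 c
    have h4 := (abs_resampledPart_sdiff_sub_le hN (s N) (u N) hA hB hAB K c).trans h3
    simpa using (ENNReal.ofReal_le_ofReal_iff hε.le).1 h4

lemma abs_sum_mul_sub_le {N : ℕ} {w : Fin N → ℝ≥0} (hw : ∑ n, w n = 1) {f g : Fin N → ℝ} {ε : ℝ}
    (h : ∀ n, |f n - g n| ≤ ε) : |∑ n, (w n : ℝ) * f n - ∑ n, (w n : ℝ) * g n| ≤ ε := by
  rw [← Finset.sum_sub_distrib]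
  refine (Finset.abs_sum_le_sum_abs _ _).trans ?_
  have hw' : ∑ n, (w n : ℝ) = 1 := by exact_mod_cast hw
  calc ∑ n, |(w n : ℝ) * f n - w n * g n| ≤ ∑ n, (w n : ℝ) * ε := by
        refine Finset.sum_le_sum fun n _ => ?_
        rw [← mul_sub, abs_mul, abs_of_nonneg (w n).coe_nonneg]
        exact mul_le_mul_of_nonneg_left (h n) (w n).coe_nonneg
    _ = ε := by rw [← Finset.sum_mul, hw', one_mul]

/-- Resampling along a sorted key with uniformly distributed inputs: the resampled points and the
remaining inputs are asymptotically distributed according to the product measure, as soon as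
points with close keys are close. -/
theorem WeakConv.resample {d : ℕ} {X : Type} [PseudoMetricSpace X] [MeasurableSpace X]
    [BorelSpace X] [SecondCountableTopology X] [MeasurableSingletonClass X]
    {key : X → unitInterval}
    (hkey : ∀ ε > 0, ∃ δ > 0, ∀ z z', |(key z : ℝ) - key z'| < δ → dist z z' ≤ ε)
    {w : (N : ℕ) → Fin N → ℝ≥0} (hw : ∀ᶠ N in atTop, ∑ n, w N n = 1)
    {z : (N : ℕ) → Fin N → X} {Q : Measure X} [IsProbabilityMeasure Q]
    (hQ : WeakConv (fun N => weightedEmpirical (w N) (z N)) Q)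
    {u : (N : ℕ) → Fin N → Cube (Fin (d + 1))}
    (hu : Tendsto (fun N => discrepancy (u N)) atTop (𝓝 0)) :
    WeakConv (fun N => weightedEmpirical (fun _ => (N : ℝ≥0)⁻¹)
      (fun n => (z N (ancestor (w N) (fun i => key (z N i)) (u N n 0) n),
        (Fin.tail (u N n) : State d)))) (Q.prod (lebCube (Fin d))) := by
  classical
  have hX : Nonempty X := nonempty_of_isProbabilityMeasure Q
  refine weakConv_of_lipschitz ?_ fun g L M hg hM => ?_
  · filter_upwards [eventually_ne_atTop 0] with N hN
    exact isProbabilityMeasure_weightedEmpirical _ (sum_inv_card hN)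
  have hgc (x : X) : LipschitzWith L fun v : State d => g (x, v) := by
    have h := hg.comp (LipschitzWith.prodMk_left x)
    rw [mul_one] at h
    exact h
  have hint (x : X) : Integrable (fun v : State d => g (x, v)) (lebCube (Fin d)) :=
    Integrable.of_bound (hgc x).continuous.aestronglyMeasurable M (ae_of_all _ fun v => hM _)
  let G : X → ℝ := fun x => ∫ v, g (x, v) ∂(lebCube (Fin d))
  have hGdist (x y : X) : |G x - G y| ≤ L * dist x y := by
    simp only [G]
    rw [← integral_sub (hint x) (hint y), ← Real.norm_eq_abs]
    refine (norm_integral_le_of_norm_le_const (C := L * dist x y)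
      (ae_of_all _ fun v => ?_)).trans (by simp)
    rw [← dist_eq_norm]
    refine (hg.dist_le_mul _ _).trans ?_
    simp [Prod.dist_eq]
  have hGc : Continuous G := (LipschitzWith.of_dist_le_mul hGdist).continuous
  have hGM (x : X) : |G x| ≤ M := by
    rw [← Real.norm_eq_abs]
    simpa using norm_integral_le_of_norm_le_const (μ := lebCube (Fin d)) (C := M)
      (f := fun v => g (x, v)) (ae_of_all _ fun v => hM (x, v))
  have hprod : ∫ y, g y ∂(Q.prod (lebCube (Fin d))) = ∫ x, G x ∂Q :=
    integral_prod g (Integrable.of_bound hg.continuous.aestronglyMeasurable M (ae_of_all _ hM))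
  rw [hprod, Metric.tendsto_nhds]
  intro ε hε
  -- Four errors of `ε / 4` are allowed: freezing `g`, freezing `G`, resampling, and convergence to
  -- `Q`. The `L + 1` avoids dividing by zero.
  have hη : 0 < ε / (4 * ((L : ℝ) + 1)) := by positivity
  have hLη : L * (ε / (4 * ((L : ℝ) + 1))) ≤ ε / 4 := by
    have : ε / (4 * ((L : ℝ) + 1)) * (L + 1) = ε / 4 := by field_simp
    linarith
  obtain ⟨δ, hδ, hδ'⟩ := hkey _ hη
  obtain ⟨K, hK⟩ := exists_nat_one_div_lt hδ
  have hK0 : (0 : ℝ) < (K : ℝ) + 1 := by positivity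
  let κ : unitInterval → ℕ := fun t => ⌊((K : ℝ) + 1) * t⌋₊
  have hκmono : Monotone κ := fun s t hst =>
    Nat.floor_mono (mul_le_mul_of_nonneg_left hst hK0.le)
  -- The key `t = 1` falls in an extra cell of index `K + 1`, hence `K + 2` cells.
  have hκlt (t : unitInterval) : κ t < K + 2 := by
    refine (Nat.floor_lt (mul_nonneg hK0.le t.2.1)).2 ?_
    push_cast
    have := mul_le_mul_of_nonneg_left t.2.2 hK0.le
    linarith
  have hκ (s t : unitInterval) (h : κ s = κ t) : |(s : ℝ) - t| < δ := by
    refine lt_trans ?_ hK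
    have h1 := Nat.floor_le (mul_nonneg hK0.le s.2.1)
    have h2 := Nat.lt_floor_add_one (((K : ℝ) + 1) * s)
    have h3 := Nat.floor_le (mul_nonneg hK0.le t.2.1)
    have h4 := Nat.lt_floor_add_one (((K : ℝ) + 1) * t)
    have h' : (⌊((K : ℝ) + 1) * s⌋₊ : ℝ) = ⌊((K : ℝ) + 1) * t⌋₊ :=
      congrArg (Nat.cast : ℕ → ℝ) h
    have e : |(s : ℝ) - t| * ((K : ℝ) + 1) = |((s : ℝ) - t) * ((K : ℝ) + 1)| := by
      rw [abs_mul, abs_of_pos hK0]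
    rw [lt_div_iff₀ hK0, e, abs_lt]
    constructor <;> linarith
  -- A representative point for each key cell; the arbitrary value serves only cells containing no
  -- key.
  let c : ℕ → X := fun k => if h : ∃ x, κ (key x) = k then h.choose else Classical.arbitrary X
  have hc (x : X) : dist x (c (κ (key x))) ≤ ε / (4 * ((L : ℝ) + 1)) := by
    have h : ∃ y, κ (key y) = κ (key x) := ⟨x, rfl⟩
    refine hδ' _ _ (hκ _ _ ?_)
    simp only [c, dif_pos h]
    exact h.choose_spec.symm
  let A : ℕ → Set unitInterval := fun k => {t | κ t < k}
  have hA (k) : IsLowerSet (A k) := fun s t hst hs => (hκmono hst).trans_lt hs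
  have hAA (k) : A k ⊆ A (k + 1) := fun s hs => Nat.lt_succ_of_lt hs
  have hmemA (k) (t : unitInterval) : t ∈ A (k + 1) \ A k ↔ κ t = k := by
    change κ t < k + 1 ∧ ¬ κ t < k ↔ κ t = k
    omega
  let s : (N : ℕ) → Fin N → unitInterval := fun N i => key (z N i)
  have hsum : Tendsto (fun N => ∑ k ∈ Finset.range (K + 2),
      (∫ v, g (c k, v) ∂(resampledPart (w N) (s N) (u N) (A (k + 1) \ A k)) -
      keyWeight (w N) (s N) (A (k + 1) \ A k) * G (c k))) atTop (𝓝 0) := by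
    have h0 : ∑ _k ∈ Finset.range (K + 2), (0 : ℝ) = 0 := Finset.sum_const_zero
    refine Eq.subst (motive := fun r : ℝ => Tendsto _ atTop (𝓝 r)) h0
      (tendsto_finsetSum _ fun k _ => ?_)
    exact tendsto_integral_resampledPart hw s hu (hA k) (hA (k + 1)) (hAA k) (hgc (c k))
      fun v => hM _
  -- Each index contributes to exactly one key cell, so summing over cells restores the full sums
  -- with the points replaced by representatives.
  have hsum_eq (N : ℕ) : ∑ k ∈ Finset.range (K + 2),
      (∫ v, g (c k, v) ∂(resampledPart (w N) (s N) (u N) (A (k + 1) \ A k)) -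
      keyWeight (w N) (s N) (A (k + 1) \ A k) * G (c k)) =
      ∑ n, (((N : ℝ≥0)⁻¹ : ℝ≥0) : ℝ) *
        g (c (κ (s N (ancestor (w N) (s N) (u N n 0) n))), Fin.tail (u N n)) -
      ∑ n, (w N n : ℝ) * G (c (κ (s N n))) := by
    rw [Finset.sum_sub_distrib]
    congr 1
    · simp only [resampledPart, integral_weightedEmpirical, hmemA]
      rw [Finset.sum_comm]
      refine Finset.sum_congr rfl fun n _ => ?_
      rw [Finset.sum_eq_single (κ (s N (ancestor (w N) (s N) (u N n 0) n)))]
      · simp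
      · intro k _ hk
        simp [Ne.symm hk]
      · intro h
        exact absurd (Finset.mem_range.2 (hκlt _)) h
    · simp only [keyWeight, hmemA, NNReal.coe_sum, Finset.sum_mul]
      rw [Finset.sum_comm]
      refine Finset.sum_congr rfl fun n _ => ?_
      rw [Finset.sum_eq_single (κ (s N n))]
      · simp
      · intro k _ hk
        simp [Ne.symm hk]
      · intro h
        exact absurd (Finset.mem_range.2 (hκlt _)) h
  have hlimQ := hQ G hGc ⟨M, hGM⟩
  filter_upwards [hw, eventually_ne_atTop 0, Metric.tendsto_nhds.1 hsum (ε / 4) (by positivity),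
    Metric.tendsto_nhds.1 hlimQ (ε / 4) (by positivity)] with N h1 h2 h3 h4
  rw [hsum_eq, Real.dist_eq, sub_zero] at h3
  rw [integral_weightedEmpirical, Real.dist_eq] at h4
  rw [integral_weightedEmpirical, Real.dist_eq]
  have h5 := abs_sum_mul_sub_le (sum_inv_card h2)
    (f := fun n => g (z N (ancestor (w N) (s N) (u N n 0) n), Fin.tail (u N n)))
    (g := fun n => g (c (κ (s N (ancestor (w N) (s N) (u N n 0) n))), Fin.tail (u N n)))
    (ε := ε / 4) (fun n => by
      rw [← Real.dist_eq]
      refine ((hg.dist_le_mul _ _).trans ?_).trans hLη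
      refine mul_le_mul_of_nonneg_left ?_ L.2
      rw [Prod.dist_eq, dist_self, max_eq_left dist_nonneg]
      exact hc _)
  have h6 := abs_sum_mul_sub_le h1 (f := fun n => G (z N n)) (g := fun n => G (c (κ (s N n))))
    (ε := ε / 4) (fun n => (hGdist _ _).trans
      ((mul_le_mul_of_nonneg_left (hc _) L.2).trans hLη))
  change |∑ n, (((N : ℝ≥0)⁻¹ : ℝ≥0) : ℝ) *
    g (z N (ancestor (w N) (s N) (u N n 0) n), Fin.tail (u N n)) - _| < _
  rw [abs_lt] at h3 h4 ⊢
  rw [abs_le] at h5 h6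
  constructor <;> linarith [h3.1, h3.2, h4.1, h4.2, h5.1, h5.2, h6.1, h6.2]

/-! ### Reweighting -/

/-- Testing against `G * f` and `G` gives the limits of numerator and denominator; the factors `1 /
N` cancel. The limit of the denominator is positive, so eventually the weights are genuinely
normalised. -/
lemma WeakConv.reweight {X : Type} [TopologicalSpace X] [MeasurableSpace X] [BorelSpace X]
    [MeasurableSingletonClass X] {x : (N : ℕ) → Fin N → X} {ν : Measure X}
    [IsProbabilityMeasure ν]
    (h : WeakConv (fun N => weightedEmpirical (fun _ => (N : ℝ≥0)⁻¹) (x N)) ν)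
    {G : X → ℝ≥0} (hG : Continuous G) {C : ℝ≥0} (hC : ∀ y, G y ≤ C)
    (hZ : ∫⁻ y, G y ∂ν ≠ 0) :
    WeakConv (fun N => weightedEmpirical (fun n => G (x N n) / ∑ k, G (x N k)) (x N))
      ((∫⁻ y, G y ∂ν)⁻¹ • ν.withDensity fun y => (G y : ℝ≥0∞)) ∧
    ∀ᶠ N in atTop, ∑ n, G (x N n) / ∑ k, G (x N k) = 1 := by
  have hGr : Continuous fun y => (G y : ℝ) := NNReal.continuous_coe.comp hG
  have hGb (y : X) : |(G y : ℝ)| ≤ C := by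
    rw [abs_of_nonneg (G y).coe_nonneg]; exact_mod_cast hC y
  have hZfin : ∫⁻ y, G y ∂ν ≠ ∞ := by
    refine ((lintegral_mono fun y => ENNReal.coe_le_coe.2 (hC y)).trans_lt ?_).ne
    simp
  have hint : ∫ y, (G y : ℝ) ∂ν = (∫⁻ y, G y ∂ν).toReal := by
    rw [integral_eq_lintegral_of_nonneg_ae (ae_of_all _ fun y => (G y).coe_nonneg)
      hGr.measurable.aestronglyMeasurable]
    simp
  have hpos : 0 < ∫ y, (G y : ℝ) ∂ν := by
    rw [hint]; exact ENNReal.toReal_pos hZ hZfin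
  have h1 := h _ hGr ⟨C, hGb⟩
  simp_rw [integral_weightedEmpirical] at h1
  refine ⟨?_, ?_⟩
  · rintro f hf ⟨D, hD⟩
    have h2 := h (fun y => G y * f y) (hGr.mul hf) ⟨C * D, fun y => by
      rw [abs_mul]; exact mul_le_mul (hGb y) (hD y) (abs_nonneg _) C.coe_nonneg⟩
    simp_rw [integral_weightedEmpirical] at h2
    have h3 := h2.div h1 hpos.ne'
    have e : ∫ y, f y ∂((∫⁻ y, G y ∂ν)⁻¹ • ν.withDensity fun y => (G y : ℝ≥0∞)) =
        (∫ y, (G y : ℝ) * f y ∂ν) / ∫ y, (G y : ℝ) ∂ν := by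
      rw [integral_smul_measure, integral_withDensity_eq_integral_smul hG.measurable, hint,
        ENNReal.toReal_inv, smul_eq_mul, div_eq_inv_mul]
      rfl
    rw [e]
    refine h3.congr' ?_
    filter_upwards [eventually_ne_atTop 0] with N hN
    have hN' : (((N : ℝ≥0)⁻¹ : ℝ≥0) : ℝ) ≠ 0 := by
      simp [hN]
    rw [integral_weightedEmpirical, Pi.div_apply, ← Finset.mul_sum, ← Finset.mul_sum,
      mul_div_mul_left _ _ hN', Finset.sum_div]
    refine Finset.sum_congr rfl fun n _ => ?_
    push_cast
    ring
  · filter_upwards [h1.eventually_const_lt hpos] with N hN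
    rw [← Finset.sum_div]
    refine div_self fun h0 => ?_
    rw [← Finset.mul_sum, ← NNReal.coe_sum, h0] at hN
    simp at hN

lemma weakConv_of_discrepancy {ι : Type} [Fintype ι] {u : (N : ℕ) → Fin N → Cube ι}
    (hu : Tendsto (fun N => discrepancy (u N)) atTop (𝓝 0)) :
    WeakConv (fun N => weightedEmpirical (fun _ => (N : ℝ≥0)⁻¹) (u N)) (lebCube ι) := by
  classical
  have hp : ∀ᶠ N : ℕ in atTop,
      IsProbabilityMeasure (weightedEmpirical (fun _ => (N : ℝ≥0)⁻¹) (u N)) := by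
    filter_upwards [eventually_ne_atTop 0] with N hN
    exact isProbabilityMeasure_weightedEmpirical _ (sum_inv_card hN)
  refine weakConv_of_lipschitz hp fun g L M hg hM => ?_
  refine tendsto_sub_nhds_zero_iff.1
    (tendsto_integral_sub_integral (ν := fun _ => lebCube ι) ?_ (by simp) ?_ hg hM)
  · filter_upwards [hp] with N hN
    simp
  · intro K ε hε
    filter_upwards [hu.eventually_le_const (ENNReal.ofReal_pos.2 hε)] with N h3 c
    exact (ENNReal.ofReal_le_ofReal_iff hε.le).1 ((abs_sub_gridCell_le K c).trans h3)

/-! ### Trajectories -/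

lemma continuous_single {d : ℕ} : Continuous (single : State d → Traj d 0) :=
  continuous_pi fun p => continuous_apply p.2

lemma continuous_state {d t : ℕ} (s : Fin (t + 1)) :
    Continuous fun z : Traj d t => state z s :=
  continuous_pi fun j => continuous_apply (s, j)

lemma continuous_snocState {d t : ℕ} :
    Continuous fun p : Traj d t × State d => snocState p.1 p.2 := by
  refine continuous_pi fun q => ?_
  obtain ⟨s, j⟩ := q
  induction s using Fin.lastCases with
  | last =>
    have : Continuous (fun p : Traj d t × State d => p.2 j) := by fun_prop
    simpa [snocState] using this
  | cast s =>
    have : Continuous (fun p : Traj d t × State d => p.1 (s, j)) := by fun_prop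
    simpa [snocState, state] using this

lemma state_snocState_castSucc {d t : ℕ} (z : Traj d t) (x : State d) (s : Fin (t + 1)) :
    state (snocState z x) s.castSucc = state z s := by
  funext j; simp [state, snocState]

lemma dist_toClosed {ι : Type} [Fintype ι] (x y : Cube ι) :
    dist (toClosed x) (toClosed y) = dist x y := rfl

/-- The pseudo-inverse `h` need not be continuous, but `z = H (h z)` and `H` is uniformly continuous
on a compact interval. -/
lemma exists_dist_le_of_rightInverse {ι : Type} [Fintype ι] {H : unitInterval → ι → unitInterval}
    (hH : Continuous H) {h : (ι → unitInterval) → unitInterval} (hh : Function.RightInverse h H) :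
    ∀ ε > 0, ∃ δ > 0, ∀ z z' : Cube ι,
      |(h (toClosed z) : ℝ) - h (toClosed z')| < δ → dist z z' ≤ ε := by
  intro ε hε
  obtain ⟨δ, hδ, hd⟩ := Metric.uniformContinuous_iff.1
    (CompactSpace.uniformContinuous_of_continuous hH) ε hε
  refine ⟨δ, hδ, fun z z' hz => ?_⟩
  rw [← dist_toClosed, ← hh (toClosed z), ← hh (toClosed z')]
  exact (hd hz).le

/-! ### Recursion for the smoothing distributions -/

namespace FeynmanKac

variable {d : ℕ} (M : FeynmanKac d)

/-- The law of the trajectories `x_{0:t+1}` when `x_{0:t}` follows the smoothing distribution and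
`x_{t+1}` is drawn from the Markov kernel. -/
noncomputable def predictive (t : ℕ) : Measure (Traj d (t + 1)) :=
  ((M.smoothing t) ⊗ₘ ((M.m (t + 1)).comap lastState measurable_lastState)).map
    (fun p => snocState p.1 p.2)

lemma pathPotential_snocState (t : ℕ) (z : Traj d t) (x : State d) :
    M.pathPotential (t + 1) (snocState z x) =
      M.pathPotential t z * M.potential (t + 1) (snocState z x) := by
  unfold pathPotential potential
  rw [Fin.prod_univ_castSucc, ← mul_assoc]
  congr 2
  refine Finset.prod_congr rfl fun s _ => ?_
  rw [state_snocState_castSucc, Fin.succ_castSucc, state_snocState_castSucc]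
  rfl

lemma isProbabilityMeasure_pathLaw (t : ℕ) : IsProbabilityMeasure (M.pathLaw t) := by
  have := M.prob_m0
  have := M.markov_m
  induction t with
  | zero => exact Measure.isProbabilityMeasure_map measurable_single.aemeasurable
  | succ t ih => exact Measure.isProbabilityMeasure_map measurable_snocState.aemeasurable

variable {M}

lemma withDensity_pathPotential_succ {t : ℕ} (hp : Measurable (M.pathPotential t))
    (hp' : Measurable (M.pathPotential (t + 1))) (hG : Measurable (M.potential (t + 1))) :
    (M.pathLaw (t + 1)).withDensity (fun z => (M.pathPotential (t + 1) z : ℝ≥0∞)) =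
      ((((M.pathLaw t).withDensity (fun z => (M.pathPotential t z : ℝ≥0∞))) ⊗ₘ
        ((M.m (t + 1)).comap lastState measurable_lastState)).map
          (fun p => snocState p.1 p.2)).withDensity
        (fun z => (M.potential (t + 1) z : ℝ≥0∞)) := by
  have := M.isProbabilityMeasure_pathLaw t
  have := M.markov_m
  ext s hs
  have hI {f : Traj d (t + 1) → ℝ≥0} (hf : Measurable f) :
      Measurable (s.indicator fun z => (f z : ℝ≥0∞)) := hf.coe_nnreal_ennreal.indicator hs
  rw [withDensity_apply _ hs, withDensity_apply _ hs, ← lintegral_indicator hs,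
    ← lintegral_indicator hs, pathLaw, lintegral_map (hI hp') measurable_snocState,
    lintegral_map (hI hG) measurable_snocState,
    Measure.lintegral_compProd (f := fun p : Traj d t × State d => s.indicator
      (fun z => (M.pathPotential (t + 1) z : ℝ≥0∞)) (snocState p.1 p.2))
      ((hI hp').comp measurable_snocState),
    Measure.lintegral_compProd (f := fun p : Traj d t × State d => s.indicator
      (fun z => (M.potential (t + 1) z : ℝ≥0∞)) (snocState p.1 p.2))
      ((hI hG).comp measurable_snocState),
    lintegral_withDensity_eq_lintegral_mul _ hp.coe_nnreal_ennreal]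
  · refine lintegral_congr fun z => ?_
    rw [Pi.mul_apply, ← lintegral_const_mul]
    · refine lintegral_congr fun x => ?_
      by_cases hx : snocState z x ∈ s
      · simp [hx, pathPotential_snocState]
      · simp [hx]
    · exact (hI hG).comp (measurable_snocState.comp measurable_prodMk_left)
  · exact ((hI hG).comp measurable_snocState).lintegral_kernel_prod_right'

/-- Either degenerate value of `Z` makes the smoothing measure zero: through a null density, or
through `∞⁻¹ = 0`. -/
lemma Z_ne_zero_and_ne_top {t : ℕ} (h : M.smoothing t ≠ 0) : M.Z t ≠ 0 ∧ M.Z t ≠ ∞ := by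
  have e : M.Z t = (M.pathLaw t).withDensity (fun z => (M.pathPotential t z : ℝ≥0∞)) univ := by
    rw [withDensity_apply _ MeasurableSet.univ, setLIntegral_univ, Z]
  constructor
  · intro h0
    refine h ?_
    rw [e, Measure.measure_univ_eq_zero] at h0
    rw [smoothing, h0, smul_zero]
  · intro h0
    refine h ?_
    rw [smoothing, h0, ENNReal.inv_top, zero_smul]

lemma isProbabilityMeasure_smoothing {t : ℕ} (h : M.smoothing t ≠ 0) :
    IsProbabilityMeasure (M.smoothing t) := by
  obtain ⟨h0, h1⟩ := Z_ne_zero_and_ne_top h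
  constructor
  rw [smoothing, Measure.smul_apply, withDensity_apply _ MeasurableSet.univ, setLIntegral_univ,
    smul_eq_mul]
  exact ENNReal.inv_mul_cancel h0 h1

/-- The one-step normalising constant is `Z (t + 1) / Z t`, so the factor `Z t` cancels. -/
lemma smoothing_succ {t : ℕ} (hp : Measurable (M.pathPotential t))
    (hp' : Measurable (M.pathPotential (t + 1))) (hG : Measurable (M.potential (t + 1)))
    (h : M.smoothing t ≠ 0) (h' : M.smoothing (t + 1) ≠ 0) :
    ∫⁻ z, M.potential (t + 1) z ∂(M.predictive t) ≠ 0 ∧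
    M.smoothing (t + 1) = (∫⁻ z, M.potential (t + 1) z ∂(M.predictive t))⁻¹ •
      (M.predictive t).withDensity (fun z => (M.potential (t + 1) z : ℝ≥0∞)) := by
  have := M.isProbabilityMeasure_pathLaw t
  have := M.markov_m
  obtain ⟨h0, h1⟩ := Z_ne_zero_and_ne_top h
  obtain ⟨h0', h1'⟩ := Z_ne_zero_and_ne_top h'
  have e1 : (M.predictive t).withDensity (fun z => (M.potential (t + 1) z : ℝ≥0∞)) =
      (M.Z t)⁻¹ •
        (M.pathLaw (t + 1)).withDensity (fun z => (M.pathPotential (t + 1) z : ℝ≥0∞)) := by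
    rw [withDensity_pathPotential_succ hp hp' hG, predictive, smoothing,
      Measure.compProd_smul_left, Measure.map_smul, withDensity_smul_measure]
  have e2 : ∫⁻ z, M.potential (t + 1) z ∂(M.predictive t) = (M.Z t)⁻¹ * M.Z (t + 1) := by
    rw [← setLIntegral_univ, ← withDensity_apply _ MeasurableSet.univ, e1, Measure.smul_apply,
      withDensity_apply _ MeasurableSet.univ, setLIntegral_univ, smul_eq_mul, ← Z]
  have hi0 : (M.Z t)⁻¹ ≠ 0 := ENNReal.inv_ne_zero.2 h1
  have hi1 : (M.Z t)⁻¹ ≠ ∞ := ENNReal.inv_ne_top.2 h0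
  rw [e2, e1, smul_smul]
  refine ⟨mul_ne_zero hi0 h0', ?_⟩
  rw [ENNReal.mul_inv (Or.inl hi0) (Or.inl hi1), mul_right_comm, ENNReal.inv_mul_cancel hi0 hi1,
    one_mul, smoothing]

/-- Drawing from the kernel amounts to applying the inverse Rosenblatt transform to an independent
uniform input, which is the form reached by the resampled pairs. -/
lemma predictive_eq_map {t : ℕ} [IsProbabilityMeasure (M.smoothing t)]
    {κ : State d → CondLaws d} (hκ : ∀ x, IsCondLaws (M.m (t + 1) x) (κ x))
    (hr : RegularRosenblatt κ) :
    M.predictive t = ((M.smoothing t).prod (lebCube (Fin d))).map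
      (fun p => snocState p.1 (invRosenblatt (κ (lastState p.1)) p.2)) := by
  have := M.markov_m
  have hc := hr.continuous_invRosenblatt fun x i => (hκ x i).1
  have hg : Measurable fun p : Traj d t × State d =>
      (p.1, invRosenblatt (κ (lastState p.1)) p.2) :=
    measurable_fst.prodMk (hc.measurable.comp
      ((measurable_lastState.comp measurable_fst).prodMk measurable_snd))
  have e : (M.smoothing t) ⊗ₘ ((M.m (t + 1)).comap lastState measurable_lastState) =
      ((M.smoothing t).prod (lebCube (Fin d))).map
        (fun p => (p.1, invRosenblatt (κ (lastState p.1)) p.2)) := by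
    ext s hs
    rw [Measure.map_apply hg hs, Measure.prod_apply (hg hs), Measure.compProd_apply hs]
    refine lintegral_congr fun z => ?_
    have hcz : Measurable (invRosenblatt (κ (lastState z))) :=
      (hc.comp (Continuous.prodMk_right (lastState z))).measurable
    rw [Kernel.comap_apply,
      ← hr.lebCube_map (fun x i => (hκ x i).1) (hκ (lastState z)),
      Measure.map_apply hcz (measurable_prodMk_left hs)]
    rfl
  rw [predictive, e, Measure.map_map measurable_snocState hg]
  rfl

end FeynmanKac

/-- Exhibits a step of the algorithm as a fixed map applied to the pairs of `WeakConv.resample`. -/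
lemma trajectories_succ {d : ℕ} (M : FeynmanKac d) (κ0 : CondLaws d)
    (κ : ℕ → State d → CondLaws d)
    (h : (t : ℕ) → (Fin (t + 1) × Fin d → unitInterval) → unitInterval) {N : ℕ}
    (u0 : Fin N → State d) (u : ℕ → Fin N → Cube (Fin (d + 1))) (t : ℕ) (n : Fin N) :
    trajectories M κ0 κ h u0 u (t + 1) n =
      (fun p : Traj d t × State d =>
        snocState p.1 (invRosenblatt (κ (t + 1) (lastState p.1)) p.2))
      (trajectories M κ0 κ h u0 u t
        (ancestor (M.weights t (trajectories M κ0 κ h u0 u t))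
          (fun k => h t (toClosed (trajectories M κ0 κ h u0 u t k))) (u (t + 1) n 0) n),
        Fin.tail (u (t + 1) n)) := by
  rw [trajectories]; rfl

end SQMC

/-! ### Induction on time and conclusion -/

theorem mainTheorem6 {d : ℕ} (hd : 0 < d) (M : FeynmanKac d) (T : ℕ)
    -- conditional distributions defining the Rosenblatt transforms of `m_0` and `m_t(x', ·)`
    (κ0 : CondLaws d) (hκ0 : IsCondLaws M.m0 κ0)
    (κ : ℕ → State d → CondLaws d)
    (hκ : ∀ t, 1 ≤ t → t ≤ T → ∀ x', IsCondLaws (M.m t x') (κ t x'))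
    -- Hilbert curves in dimension `d (t + 1)` and their pseudo-inverses
    (H : (t : ℕ) → unitInterval → (Fin (t + 1) × Fin d → unitInterval)) (hH : ∀ t < T, IsHilbertCurve (H t))
    (h : (t : ℕ) → (Fin (t + 1) × Fin d → unitInterval) → unitInterval)
    (hh : ∀ t < T, Function.RightInverse (h t) (H t))
    -- input point sets
    (u0 : (N : ℕ) → Fin N → State d)
    (u : (N : ℕ) → ℕ → Fin N → Cube (Fin (d + 1)))
    (hu0 : Tendsto (fun N => discrepancy (u0 N)) atTop (𝓝 0))
    (hu : ∀ t, 1 ≤ t → t ≤ T → Tendsto (fun N => discrepancy (u N t)) atTop (𝓝 0))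
    (hu_sorted : ∀ t, 1 ≤ t → t ≤ T → ∀ N, Monotone (fun n => u N t n 0))
    -- the particles are pairwise distinct
    (h1 : ∀ t ≤ T, ∀ N, Function.Injective
      (fun n => lastState (trajectories M κ0 κ h (u0 N) (u N) t n)))
    -- the potentials are continuous and bounded
    (h2_zero : Continuous M.G0 ∧ ∃ C, ∀ x, M.G0 x ≤ C)
    (h2 : ∀ t, 1 ≤ t → t ≤ T →
      Continuous (fun p : State d × State d => M.G t p.1 p.2) ∧ ∃ C, ∀ x' x, M.G t x' x ≤ C)
    -- regularity of the Rosenblatt transforms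
    (h3_zero : RegularRosenblatt (fun _ : Unit => κ0))
    (h3 : ∀ t, 1 ≤ t → t ≤ T → RegularRosenblatt (κ t))
    -- the smoothing distributions have strictly positive bounded densities
    (h4 : ∀ t ≤ T, ∃ p : Traj d t → ℝ≥0, Measurable p ∧ (∀ z, 0 < p z) ∧ (∃ C, ∀ z, p z ≤ C) ∧
      M.smoothing t = (lebCube _).withDensity (fun z => (p z : ℝ≥0∞))) :
    ∀ t ≤ T, Tendsto
      (fun N => extremeNorm
        (weightedEmpirical
          (M.weights t (trajectories M κ0 κ h (u0 N) (u N) t))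
          (trajectories M κ0 κ h (u0 N) (u N) t))
        (M.smoothing t))
      atTop (𝓝 0) := by
  have hne : ∀ t ≤ T, M.smoothing t ≠ 0 := by
    intro t ht h0
    obtain ⟨p, hpm, hp0, -, hp⟩ := h4 t ht
    rw [h0] at hp
    have h5 := (withDensity_eq_zero_iff hpm.coe_nnreal_ennreal.aemeasurable).1 hp.symm
    obtain ⟨z, hz⟩ := h5.exists
    exact (hp0 z).ne' (by simpa using hz)
  have hpot : ∀ t ≤ T, Continuous (M.potential t) ∧ ∃ C, ∀ z, M.potential t z ≤ C := by
    intro t ht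
    cases t with
    | zero =>
      obtain ⟨hc, C, hC⟩ := h2_zero
      exact ⟨hc.comp (continuous_state 0), C, fun z => hC _⟩
    | succ t =>
      obtain ⟨hc, C, hC⟩ := h2 (t + 1) (Nat.le_add_left _ _) ht
      exact ⟨hc.comp ((continuous_state _).prodMk (continuous_state _)), C, fun z => hC _ _⟩
  have hpath : ∀ t ≤ T, Measurable (M.pathPotential t) := by
    intro t ht
    refine Continuous.measurable ((h2_zero.1.comp (continuous_state 0)).mul
      (continuous_finsetProd _ fun s _ => ?_))
    have hs : (s : ℕ) + 1 ≤ T := by have := s.2; omega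
    exact (h2 (s + 1) (Nat.le_add_left _ _) hs).1.comp
      ((continuous_state s.castSucc).prodMk (continuous_state s.succ))
  -- The eventual normalisation of the weights is carried along because the next resampling requires
  -- it.
  have key : ∀ t ≤ T,
      WeakConv (fun N => weightedEmpirical
        (M.weights t (trajectories M κ0 κ h (u0 N) (u N) t))
        (trajectories M κ0 κ h (u0 N) (u N) t)) (M.smoothing t) ∧
      ∀ᶠ N in atTop, ∑ n, M.weights t (trajectories M κ0 κ h (u0 N) (u N) t) n = 1 := by
    intro t
    induction t with
    | zero =>
      intro ht
      have := M.prob_m0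
      obtain ⟨hc, C, hC⟩ := hpot 0 ht
      have hF := h3_zero.continuous_invRosenblatt fun _ i => (hκ0 i).1
      have hF' : Continuous fun v : State d => single (invRosenblatt κ0 v) :=
        continuous_single.comp (hF.comp (Continuous.prodMk_right ()))
      have hw := (weakConv_of_discrepancy hu0).map hF'
      simp_rw [map_weightedEmpirical _ _ hF'.measurable] at hw
      have hF0 : Measurable (invRosenblatt κ0) := (hF.comp (Continuous.prodMk_right ())).measurable
      have e : (lebCube (Fin d)).map (fun v => single (invRosenblatt κ0 v)) = M.pathLaw 0 := by
        rw [FeynmanKac.pathLaw, ← h3_zero.lebCube_map (a := ()) (fun _ i => (hκ0 i).1) hκ0,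
          Measure.map_map measurable_single hF0]
        rfl
      rw [e] at hw
      have hpp : M.pathPotential 0 = M.potential 0 := by
        funext z; simp [FeynmanKac.pathPotential, FeynmanKac.potential]
      have := M.isProbabilityMeasure_pathLaw 0
      have hZ := (FeynmanKac.Z_ne_zero_and_ne_top (hne 0 ht)).1
      rw [FeynmanKac.Z, hpp] at hZ
      have hfin := hw.reweight hc hC hZ
      rw [FeynmanKac.smoothing, FeynmanKac.Z, hpp]
      exact hfin
    | succ t ih =>
      intro ht
      obtain ⟨ih1, ih2⟩ := ih (Nat.le_of_succ_le ht)
      have hsm := FeynmanKac.isProbabilityMeasure_smoothing (hne t (Nat.le_of_succ_le ht))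
      have h1t : 1 ≤ t + 1 := Nat.le_add_left _ _
      obtain ⟨hc, C, hC⟩ := hpot (t + 1) ht
      have hres := WeakConv.resample (key := fun z => h t (toClosed z))
        (exists_dist_le_of_rightInverse (hH t ht).continuous (hh t ht)) ih2 ih1 (hu (t + 1) h1t ht)
      have hF := (h3 (t + 1) h1t ht).continuous_invRosenblatt
        fun x i => (hκ (t + 1) h1t ht x i).1
      have hΨ : Continuous fun p : Traj d t × State d =>
          snocState p.1 (invRosenblatt (κ (t + 1) (lastState p.1)) p.2) :=
        continuous_snocState.comp (continuous_fst.prodMk (hF.comp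
          (((continuous_state (Fin.last t)).comp continuous_fst).prodMk continuous_snd)))
      have hw := hres.map hΨ
      simp_rw [map_weightedEmpirical _ _ hΨ.measurable] at hw
      rw [← FeynmanKac.predictive_eq_map (hκ (t + 1) h1t ht) (h3 (t + 1) h1t ht)] at hw
      obtain ⟨hZ, hsucc⟩ := FeynmanKac.smoothing_succ (hpath t (Nat.le_of_succ_le ht))
        (hpath (t + 1) ht) hc.measurable (hne t (Nat.le_of_succ_le ht)) (hne (t + 1) ht)
      have : IsProbabilityMeasure (M.predictive t) := by
        have := M.markov_m
        exact Measure.isProbabilityMeasure_map measurable_snocState.aemeasurable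
      have htraj (N : ℕ) := funext (trajectories_succ M κ0 κ h (u0 N) (u N) t)
      simp_rw [htraj, hsucc]
      exact hw.reweight hc hC hZ
  intro t ht
  obtain ⟨hw, hs⟩ := key t ht
  have := FeynmanKac.isProbabilityMeasure_smoothing (hne t ht)
  obtain ⟨p, -, -, ⟨C, hC⟩, hp⟩ := h4 t ht
  -- The upper bound of the density gives the domination by Lebesgue measure that makes the
  -- convergence uniform over boxes.
  refine hw.tendsto_extremeNorm (C := C) ?_ ?_
  · filter_upwards [hs] with N hN
    exact isProbabilityMeasure_weightedEmpirical _ hN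
  · rw [hp, ← withDensity_const]
    exact withDensity_mono (ae_of_all _ fun z => ENNReal.coe_le_coe.2 (hC z))
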